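/- All fields have characteristic zero. Let $F/K$ be an algebraic function field of one variable (i.e. $F$ is a finite extension of $K(x)$ for some $x\in F$ transcendental over $K$), let $D_0$ be a derivation of $F$ and $\tau_0\colon F\to F$ an injective field endomorphism (no compatibility of $D_0,\tau_0$ with $K$ is required), and let $s\in F^\times$ be such that $D_0\tau_0=s\,\tau_0D_0$. Let $A=\begin{pmatrix}1&r\\1&0\end{pmatrix}$ with $r\in F$, $r\neq 0$, $D_0r\neq 0$, and for $i\ge 1$ write $$A_i=(\tau_0^{i-1}A)(\tau_0^{i-2}A)\cdots(\tau_0A)A=\begin{pmatrix}a^{(i)}&b^{(i)}\\c^{(i)}&d^{(i)}\end{pmatrix},$$ where $\tau_0$ acts entrywise. An element $y$ of a difference overfield $(L,\sigma)$ of $(F,\tau_0)$ (a field extension $L/F$ with an injective endomorphism $\sigma$ extending $\tau_0$) is called a solution of $\mathrm{Eq}(A,i)$ if $$\sigma^i(y)\,(c^{(i)}y+d^{(i)})=a^{(i)}y+b^{(i)}.$$ In particular $\mathrm{Eq}(A,1)$ is $\sigma(y)\,y=y+r$, i.e. the Tietze Riccati equation $\sigma(y)=1+r/y$. Suppose that: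 1. there is a place $P$ of $F/K$, with normalized discrete valuation $v_P$, such that $v_P(\tau_0^i r)>0$ for all $i\ge 0$; 2. for every $i\ge 1$, $\mathrm{Eq}(A,i)$ has no solution algebraic over $F$ in any difference overfield of $(F,\tau_0)$. Let $U/F$ be a field extension with a derivation $D$ of $U$ extending $D_0$ and an injective endomorphism $\tau$ of $U$ extending $\tau_0$ such that $D\tau=s\,\tau D$ on $U$. If there is a solution $f\in U$ of $\mathrm{Eq}(A,1)$ that is differentially algebraic over $F$, i.e. $\operatorname{tr.deg} F(f,Df,D^2f,\dots)/F<\infty$, then there exists $g\in F$ such that $$\tau^2(sr)\,\tau(s)\,s\,\tau^3(g)+(\tau(r)+1)\,\tau(s)\,s\,\tau^2(g)-(\tau(r)+1)\,s\,\tau(g)-rg+s\,\tau\!\left(\frac{D(r)}{r}\right)=0.$$ -/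

import Mathlib

open scoped IntermediateField

universe u v

/-- `F / K` is an algebraic function field of one variable: `F` is a finite extension of `K(x)`
for some `x` transcendental over `K`. -/
def IsAlgFunctionField (K : Type v) (F : Type u) [Field K] [Field F] [Algebra K F] : Prop :=
  ∃ x : F, Transcendental K x ∧ FiniteDimensional K⟮x⟯ F

/-- A place of `F / K`, given by its valuation ring `𝒪_P`, a proper valuation ring of `F`
that contains `K`. The place itself is the maximal ideal of `𝒪_P`. -/
structure FunctionFieldPlace (K : Type v) (F : Type u) [Field K] [Field F] [Algebra K F] where
  /-- the valuation ring of the place -/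
  ring : ValuationSubring F
  algebraMap_mem : ∀ a : K, algebraMap K F a ∈ ring
  ne_top : ring ≠ ⊤

/-- `w` is the normalized discrete valuation `v_P` of `F / K` associated with the place `P`:
it is trivial on `K`, takes the value `1`, and its valuation ring is `𝒪_P`. -/
structure FunctionFieldPlace.IsNormalizedValuation {K : Type v} {F : Type u}
    [Field K] [Field F] [Algebra K F] (P : FunctionFieldPlace K F)
    (w : AddValuation F (WithTop ℤ)) : Prop where
  map_algebraMap : ∀ a : K, a ≠ 0 → w (algebraMap K F a) = 0
  exists_eq_one : ∃ z : F, w z = 1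
  mem_ring_iff : ∀ x : F, x ∈ P.ring ↔ 0 ≤ w x

/-- `(L, τ)` is a difference overfield of `(F, τ₀)`. The transforming operators are ring
endomorphisms of fields, hence injective. -/
def IsDifferenceOverfield {F : Type u} {L : Type v} [Field F] [Field L] [Algebra F L]
    (τ₀ : F →+* F) (τ : L →+* L) : Prop :=
  ∀ a : F, τ (algebraMap F L a) = algebraMap F L (τ₀ a)

/-- `(L, D)` is a differential overfield of `(F, D₀)`. -/
def IsDifferentialOverfield {F : Type u} {L : Type v} [Field F] [Field L] [Algebra F L]
    (D₀ : Derivation ℤ F F) (D : Derivation ℤ L L) : Prop :=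
  ∀ a : F, D (algebraMap F L a) = algebraMap F L (D₀ a)

/-- The matrix `A_i = (τ^{i-1} A) (τ^{i-2} A) ⋯ (τ A) A`. -/
def transformProd {F : Type u} [Field F] (τ : F →+* F) (A : Matrix (Fin 2) (Fin 2) F) :
    ℕ → Matrix (Fin 2) (Fin 2) F
  | 0 => 1
  | i + 1 => A.map (τ^[i]) * transformProd τ A i

/-- `y`, an element of the difference overfield `(L, τ)` of `(F, τ₀)`, satisfies `Eq(A, i)`:
`τ^i(y) (c y + d) = a y + b`, where `a, b, c, d` are the entries of `A_i`. -/
def IsSolutionEq {F : Type u} {L : Type v} [Field F] [Field L] [Algebra F L]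
    (τ₀ : F →+* F) (τ : L →+* L) (A : Matrix (Fin 2) (Fin 2) F) (i : ℕ) (y : L) : Prop :=
  τ^[i] y * (algebraMap F L (transformProd τ₀ A i 1 0) * y
      + algebraMap F L (transformProd τ₀ A i 1 1))
    = algebraMap F L (transformProd τ₀ A i 0 0) * y + algebraMap F L (transformProd τ₀ A i 0 1)

/-- `Eq(A, i)` over `(F, τ₀)` has a solution algebraic over `F` in some difference overfield.
Overfields in the universe of `F` suffice: an element algebraic over `F` generates a difference
overfield that is algebraic over `F`, hence isomorphic to one inside `AlgebraicClosure F`. -/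
def HasAlgebraicSolutionEq {F : Type u} [Field F] (τ₀ : F →+* F)
    (A : Matrix (Fin 2) (Fin 2) F) (i : ℕ) : Prop :=
  ∃ (L : Type u) (_ : Field L) (_ : Algebra F L) (τ : L →+* L) (y : L),
    IsDifferenceOverfield τ₀ τ ∧ IsAlgebraic F y ∧ IsSolutionEq τ₀ τ A i y

/-- `f` is differentially algebraic over `F`: `tr.deg F(f, Df, D²f, …) / F < ∞`. -/
def IsDifferentiallyAlgebraic (F : Type u) {L : Type v} [Field F] [Field L] [Algebra F L]
    (D : Derivation ℤ L L) (f : L) : Prop :=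
  Algebra.trdeg F (IntermediateField.adjoin F (Set.range fun n : ℕ => D^[n] f)) < Cardinal.aleph0

/-! Differentiating `τ f * f = f + r` shows that every `D^m f` with `m ≥ 1` satisfies an affine
difference equation `τ x = α_m x + β_m`, where `α_m = -r / (f² s^m)` and `β_m` lies in `F(f, …,
D^(m-1) f)`. If `f` is differentially algebraic, some `D^n f` is algebraic over the preceding
derivatives, and the mean of its conjugates solves the same equation in the preceding field. So
there is a least level `m` at which the equation is solvable in the preceding field (`JetSolvable`).
The heart of the proof is that `m = 1`.

Suppose `m ≥ 2`. A solution is a rational function of `D^(m-1) f`. Its denominator would be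
semi-invariant and would make level `m - 1` solvable, so it is a polynomial, and weights in `f`
bound its degree by that of `β_m`. Comparing top coefficients leaves an equation whose inhomogeneity
is a logarithmic derivative of `f`, or, when `m = 2`, a multiple of `1 / f`. Descending through the
lower levels always ends at `-r / f² * τ y = y - κ / f` with `κ ≠ 0` and `y` in `F(f)`, which
`riccati_no_invariant_connection` excludes.

For `m = 1` the solution lies in `F(f)`; it is a polynomial in `f` of degree at most 2, and
eliminating its lower coefficients gives the third order equation (`exists_third_order_solution`).

Inside `F(f)`, everything rests on `hasAlgebraicSolutionEq_of_riccatiTwist_eq`: the finitely many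
projective zeros of a semi-invariant binary form are moved among themselves by the inverse twisted
Möbius map, so one recurs and solves some `Eq(A, i)`. -/

open Polynomial

/-! ### Rational solutions of affine difference equations in one variable. -/

section AffineTwist

variable {K : Type*} {U : Type*} [Field K] [Field U] [Algebra K U]

/-- The action on `K[X]` of an endomorphism that restricts to `φ` on `K` and maps `X` to
`α X + β`. -/
noncomputable def affineTwist (φ : K →+* K) (α β : K) (p : K[X]) : K[X] :=
  (p.map φ).comp (C α * X + C β)

theorem aeval_affineTwist {φ : K →+* K} {τ : U →+* U}
    (hφ : ∀ a, τ (algebraMap K U a) = algebraMap K U (φ a)) {α β : K} {t : U}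
    (ht : τ t = algebraMap K U α * t + algebraMap K U β) (p : K[X]) :
    aeval t (affineTwist φ α β p) = τ (aeval t p) := by
  have h : (algebraMap K U).comp φ = τ.comp (algebraMap K U) := by ext a; simp [hφ]
  simp only [affineTwist, aeval_def, eval₂_comp, eval₂_map, h, hom_eval₂]
  simp [ht]

theorem natDegree_affineTwist (φ : K →+* K) {α : K} (hα : α ≠ 0) (β : K) (p : K[X]) :
    (affineTwist φ α β p).natDegree = p.natDegree := by
  rw [affineTwist, natDegree_comp, natDegree_map, natDegree_linear hα, mul_one]

theorem affineTwist_ne_zero (φ : K →+* K) {α : K} (hα : α ≠ 0) (β : K) {p : K[X]} (hp : p ≠ 0) :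
    affineTwist φ α β p ≠ 0 := by
  rw [affineTwist, Ne, comp_eq_zero_iff]
  rintro (h | ⟨-, h⟩)
  · exact hp ((Polynomial.map_eq_zero φ).1 h)
  · have := congrArg (coeff · 1) h
    simp at this
    exact hα this

theorem coeff_affineTwist (φ : K →+* K) {α : K} (hα : α ≠ 0) (β : K) {p : K[X]} {d : ℕ}
    (hp : p.natDegree ≤ d) : (affineTwist φ α β p).coeff d = φ (p.coeff d) * α ^ d := by
  rcases hp.eq_or_lt with rfl | h
  · have h1 := natDegree_affineTwist φ hα β p
    conv_lhs => rw [← h1]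
    rw [coeff_natDegree, affineTwist, leadingCoeff_comp (by rw [natDegree_linear hα]; exact one_ne_zero),
      leadingCoeff_map, natDegree_map, leadingCoeff_linear hα, coeff_natDegree]
  · rw [coeff_eq_zero_of_natDegree_lt h, coeff_eq_zero_of_natDegree_lt]
    · simp
    · rwa [natDegree_affineTwist φ hα]

theorem derivative_affineTwist (φ : K →+* K) (α β : K) (p : K[X]) :
    derivative (affineTwist φ α β p) = C α * affineTwist φ α β (derivative p) := by
  simp [affineTwist, derivative_comp, derivative_map]

/-- A nonconstant polynomial that is semi-invariant under an affine twist yields a fixed point of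
the affine map. -/
theorem exists_fixedPoint_of_affineTwist_eq [CharZero K] {φ : K →+* K} {α β : K} (hα : α ≠ 0) :
    ∀ {p : K[X]} {c : K}, p.natDegree ≠ 0 → affineTwist φ α β p = C c * p →
      ∃ z : K, φ z = α * z + β := by
  suffices H : ∀ (d : ℕ) (p : K[X]) (c : K), p.natDegree = d + 1 →
      affineTwist φ α β p = C c * p → ∃ z : K, φ z = α * z + β by
    intro p c hp h
    exact H (p.natDegree - 1) p c (by omega) h
  intro d
  -- Differentiation preserves semi-invariance, dividing the multiplier by `α`; in characteristic
  -- zero it can be repeated down to degree one, where the root is the fixed point.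
  induction d with
  | zero =>
    intro p c hp h
    obtain ⟨a, ha, b, rfl⟩ := natDegree_eq_one.1 hp
    have h1 := congrArg (coeff · 1) h
    have h0 := congrArg (coeff · 0) h
    simp [affineTwist, mul_coeff_zero] at h1 h0
    have hφa : φ a ≠ 0 := by simpa using ha
    refine ⟨-b / a, ?_⟩
    rw [map_div₀, map_neg]
    field_simp
    linear_combination (-a) * h0 + b * h1
  | succ d ih =>
    intro p c hp h
    refine ih (derivative p) (c / α) (by rw [natDegree_derivative, hp]; rfl) ?_
    have h1 := congrArg derivative h
    rw [derivative_affineTwist, derivative_C_mul] at h1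
    have h2 : C α ≠ (0 : K[X]) := by simpa using hα
    apply mul_left_cancel₀ h2
    rw [h1, ← mul_assoc, ← C_mul, mul_div_cancel₀ _ hα]

/-- The twist of the minimal polynomial of `t` again vanishes at `t` and has the same degree, so the
minimal polynomial is semi-invariant. -/
theorem exists_fixedPoint_of_isAlgebraic [CharZero K] {φ : K →+* K} {τ : U →+* U}
    (hφ : ∀ a, τ (algebraMap K U a) = algebraMap K U (φ a)) {α β : K} (hα : α ≠ 0) {t : U}
    (ht : τ t = algebraMap K U α * t + algebraMap K U β) (hta : IsAlgebraic K t) :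
    ∃ z : K, φ z = α * z + β := by
  have hint := hta.isIntegral
  have hd : minpoly K t ∣ affineTwist φ α β (minpoly K t) := by
    apply minpoly.dvd
    rw [aeval_affineTwist hφ ht, minpoly.aeval, map_zero]
  obtain ⟨w, hw⟩ := hd
  have hne := affineTwist_ne_zero φ hα β (minpoly.ne_zero hint)
  have hw0 : w ≠ 0 := by rintro rfl; exact hne (by rw [hw, mul_zero])
  have hdeg := congrArg natDegree hw
  rw [natDegree_affineTwist φ hα, natDegree_mul (minpoly.ne_zero hint) hw0] at hdeg
  obtain ⟨c, rfl⟩ := natDegree_eq_zero.1 (show w.natDegree = 0 by omega)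
  exact exists_fixedPoint_of_affineTwist_eq hα (minpoly.natDegree_pos hint).ne'
    (hw.trans (mul_comm _ _))

theorem aeval_injective_of_transcendental {t : U} (ht : Transcendental K t) :
    Function.Injective (aeval t : K[X] → U) :=
  transcendental_iff_injective.1 ht

/-- A rational expression in `t` that solves an affine difference equation with polynomial
inhomogeneity is a polynomial, unless the affine map of `t` has a fixed point in the base field. -/
theorem exists_aeval_eq_of_affine_eq [CharZero K] {φ : K →+* K} {τ : U →+* U}
    (hφ : ∀ a, τ (algebraMap K U a) = algebraMap K U (φ a)) {α β : K} (hα : α ≠ 0) {t : U}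
    (ht : τ t = algebraMap K U α * t + algebraMap K U β)
    (htr : Transcendental K t) (hno : ¬ ∃ z : K, φ z = α * z + β)
    {y : U} (hy : ∃ p q : K[X], y = aeval t p / aeval t q) {c : K} (hc : c ≠ 0) {e : K[X]}
    (hyτ : τ y = algebraMap K U c * y + aeval t e) :
    ∃ p : K[X], y = aeval t p := by
  classical
  have hinj := aeval_injective_of_transcendental htr
  -- The ideal of denominators of `y`. Its generator is the reduced denominator, so no coprime
  -- numerator has to be carried along.
  let I : Ideal K[X] :=
    { carrier := {q | ∃ p : K[X], aeval t q * y = aeval t p}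
      zero_mem' := ⟨0, by simp⟩
      add_mem' := by
        rintro a b ⟨p, hp⟩ ⟨q, hq⟩
        exact ⟨p + q, by simp [add_mul, hp, hq]⟩
      smul_mem' := by
        rintro a b ⟨p, hp⟩
        exact ⟨a * p, by simp [mul_assoc, hp]⟩ }
  have hImem : ∀ q, q ∈ I ↔ ∃ p : K[X], aeval t q * y = aeval t p := fun q => Iff.rfl
  obtain ⟨q₀, hq₀⟩ := (IsPrincipalIdealRing.principal I).principal
  have hdvd : ∀ q, q ∈ I ↔ q₀ ∣ q := fun q => by rw [hq₀]; exact Ideal.mem_span_singleton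
  have hq₀ne : q₀ ≠ 0 := by
    rintro rfl
    obtain ⟨p, q, rfl⟩ := hy
    by_cases hq : q = 0
    · have : (1 : K[X]) ∈ I := (hImem 1).2 ⟨0, by simp [hq]⟩
      exact one_ne_zero (zero_dvd_iff.1 ((hdvd 1).1 this))
    · have hq' : aeval t q ≠ 0 := fun h => hq (hinj (by simpa using h))
      have : q ∈ I := (hImem q).2 ⟨p, by field_simp⟩
      exact hq (zero_dvd_iff.1 ((hdvd q).1 this))
  obtain ⟨p₀, hp₀⟩ := (hImem q₀).1 ((hdvd q₀).2 dvd_rfl)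
  -- Applying `τ` to `q₀ y = p₀` and solving for `y` through its equation shows that the twist of
  -- `q₀` is a denominator too.
  have htw : q₀ ∣ affineTwist φ α β q₀ := by
    rw [← hdvd, hImem]
    refine ⟨C c⁻¹ * (affineTwist φ α β p₀ - affineTwist φ α β q₀ * e), ?_⟩
    have h1 := congrArg τ hp₀
    rw [map_mul, hyτ, ← aeval_affineTwist hφ ht, ← aeval_affineTwist hφ ht] at h1
    simp only [map_mul, map_sub, aeval_C, ← h1, map_inv₀]
    have hc' : algebraMap K U c ≠ 0 := by simpa using hc
    field_simp
    ring
  obtain ⟨w, hw⟩ := htw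
  have hne := affineTwist_ne_zero φ hα β hq₀ne
  have hw0 : w ≠ 0 := by rintro rfl; exact hne (by rw [hw, mul_zero])
  have hdeg := congrArg natDegree hw
  rw [natDegree_affineTwist φ hα, natDegree_mul hq₀ne hw0] at hdeg
  obtain ⟨d, rfl⟩ := natDegree_eq_zero.1 (show w.natDegree = 0 by omega)
  have hq₀d : q₀.natDegree = 0 := by
    by_contra h
    exact hno (exists_fixedPoint_of_affineTwist_eq hα h (hw.trans (mul_comm _ _)))
  obtain ⟨b, rfl⟩ := natDegree_eq_zero.1 hq₀d
  have hb : b ≠ 0 := by rintro rfl; simp at hq₀ne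
  have hb' : algebraMap K U b ≠ 0 := by simpa using hb
  refine ⟨C b⁻¹ * p₀, ?_⟩
  rw [map_mul, ← hp₀, aeval_C, aeval_C, map_inv₀, inv_mul_cancel_left₀ hb']

theorem mem_range_algebraMap_of_semiinvariant [CharZero K] {φ : K →+* K} {τ : U →+* U}
    (hφ : ∀ a, τ (algebraMap K U a) = algebraMap K U (φ a)) {α β : K} (hα : α ≠ 0) {t : U}
    (ht : τ t = algebraMap K U α * t + algebraMap K U β)
    (htr : Transcendental K t) (hno : ¬ ∃ z : K, φ z = α * z + β)
    {y : U} (hy : ∃ p q : K[X], y = aeval t p / aeval t q) {c : K} (hc : c ≠ 0)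
    (hyτ : τ y = algebraMap K U c * y) :
    ∃ a : K, y = algebraMap K U a := by
  obtain ⟨p, rfl⟩ := exists_aeval_eq_of_affine_eq hφ hα ht htr hno hy hc (e := 0)
    (by simpa using hyτ)
  have h : affineTwist φ α β p = C c * p := by
    apply aeval_injective_of_transcendental htr
    rw [aeval_affineTwist hφ ht, hyτ, map_mul, aeval_C]
  have hd : p.natDegree = 0 := by
    by_contra hd
    exact hno (exists_fixedPoint_of_affineTwist_eq hα hd h)
  obtain ⟨a, rfl⟩ := natDegree_eq_zero.1 hd
  exact ⟨a, by simp⟩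

/-- Degree bound and comparison of top coefficients for rational solutions of an affine
difference equation. -/
theorem exists_aeval_natDegree_le_of_affine_eq [CharZero K] {φ : K →+* K} {τ : U →+* U}
    (hφ : ∀ a, τ (algebraMap K U a) = algebraMap K U (φ a)) {α β : K} (hα : α ≠ 0) {t : U}
    (ht : τ t = algebraMap K U α * t + algebraMap K U β)
    (htr : Transcendental K t) (hno : ¬ ∃ z : K, φ z = α * z + β)
    {y : U} (hy : ∃ p q : K[X], y = aeval t p / aeval t q) {c : K} (hc : c ≠ 0) {e : K[X]}
    (hyτ : τ y = algebraMap K U c * y + aeval t e) {k : ℕ} (hek : e.natDegree ≤ k)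
    (hk : ∀ d, k < d → ∀ a : K, φ a * α ^ d = c * a → a = 0) :
    ∃ p : K[X], y = aeval t p ∧ p.natDegree ≤ k ∧
      φ (p.coeff k) * α ^ k = c * p.coeff k + e.coeff k := by
  obtain ⟨p, rfl⟩ := exists_aeval_eq_of_affine_eq hφ hα ht htr hno hy hc hyτ
  have h : affineTwist φ α β p = C c * p + e := by
    apply aeval_injective_of_transcendental htr
    rw [aeval_affineTwist hφ ht, hyτ, map_add, map_mul, aeval_C]
  have hcoeff : ∀ d, p.natDegree ≤ d → φ (p.coeff d) * α ^ d = c * p.coeff d + e.coeff d := by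
    intro d hd
    rw [← coeff_affineTwist φ hα β hd, h, coeff_add, coeff_C_mul]
  -- Above degree `k` the inhomogeneity is silent, so the leading coefficient satisfies the
  -- homogeneous equation excluded by `hk`.
  have hdeg : p.natDegree ≤ k := by
    by_contra! hlt
    have h1 := hk _ hlt (p.coeff p.natDegree) (by
      rw [hcoeff _ le_rfl, coeff_eq_zero_of_natDegree_lt (hek.trans_lt hlt), add_zero])
    rw [coeff_natDegree, leadingCoeff_eq_zero] at h1
    simp [h1] at hlt
  exact ⟨p, rfl, hdeg, hcoeff k hdeg⟩

end AffineTwist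

/-! ### The Riccati map on polynomials and binary forms. -/

section RiccatiTwist

variable {F : Type u} {U : Type v} [Field F] [Field U] [Algebra F U]

/-- An endomorphism of a field extends to its algebraic closure. -/
theorem exists_ringHom_algebraicClosure_extending (φ : F →+* F) :
    ∃ σ : AlgebraicClosure F →+* AlgebraicClosure F,
      ∀ a, σ (algebraMap F _ a) = algebraMap F _ (φ a) := by
  -- Source and target are kept apart because the target becomes an `F`-algebra through `φ`, which
  -- differs from its usual structure.
  have key : ∀ {L M : Type u} [Field L] [Field M] [Algebra F L] [Algebra.IsAlgebraic F L]
      [IsAlgClosed M] (i : F →+* M), ∃ σ : L →+* M, ∀ a, σ (algebraMap F L a) = i a := by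
    intro L M _ _ _ _ _ i
    let := i.toAlgebra
    exact ⟨(IsAlgClosed.lift : L →ₐ[F] M), fun a => (IsAlgClosed.lift : L →ₐ[F] M).commutes a⟩
  exact key ((algebraMap F (AlgebraicClosure F)).comp φ)

/-- The action of `X ↦ (X + r) / X` on polynomials of formal degree `N`, with the denominator
`X ^ N` cleared. -/
noncomputable def riccatiTwist (φ : F →+* F) (r : F) (N : ℕ) (p : F[X]) : F[X] :=
  ∑ i ∈ Finset.range (N + 1), C (φ (p.coeff i)) * (X + C r) ^ i * X ^ (N - i)

theorem aeval_riccatiTwist {φ : F →+* F} {τ : U →+* U}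
    (hφ : ∀ a, τ (algebraMap F U a) = algebraMap F U (φ a)) {r : F} {f : U}
    (hf : τ f * f = f + algebraMap F U r) {N : ℕ} {p : F[X]} (hp : p.natDegree ≤ N) :
    aeval f (riccatiTwist φ r N p) = f ^ N * τ (aeval f p) := by
  rw [aeval_eq_sum_range' (Nat.lt_succ_of_le hp), riccatiTwist, map_sum, map_sum, Finset.mul_sum]
  refine Finset.sum_congr rfl fun i hi => ?_
  have hi' : i ≤ N := Nat.lt_succ_iff.1 (Finset.mem_range.1 hi)
  obtain ⟨k, rfl⟩ := Nat.exists_eq_add_of_le hi'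
  simp only [map_mul, map_pow, map_add, aeval_C, aeval_X, Algebra.smul_def, hφ, ← hf,
    Nat.add_sub_cancel_left]
  ring

/-- Only the top term escapes a factor `X`. When `N` is the true degree this constant term is
nonzero, so the twist is prime to `X`; this drives the later arguments in `F(f)`. -/
theorem coeff_zero_riccatiTwist (φ : F →+* F) (r : F) (N : ℕ) (p : F[X]) :
    (riccatiTwist φ r N p).coeff 0 = φ (p.coeff N) * r ^ N := by
  rw [coeff_zero_eq_eval_zero, riccatiTwist, eval_finsetSum, Finset.sum_range_succ,
    Finset.sum_eq_zero]
  · simp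
  · intro i hi
    have : N - i ≠ 0 := by have := Finset.mem_range.1 hi; omega
    simp [this]

theorem natDegree_riccatiTwist_le (φ : F →+* F) (r : F) (N : ℕ) (p : F[X]) :
    (riccatiTwist φ r N p).natDegree ≤ N := by
  refine natDegree_sum_le_of_forall_le _ _ fun i hi => ?_
  have hi' : i ≤ N := Nat.lt_succ_iff.1 (Finset.mem_range.1 hi)
  refine natDegree_mul_le.trans ?_
  have h1 : (C (φ (p.coeff i)) * (X + C r) ^ i).natDegree ≤ i :=
    (natDegree_C_mul_le _ _).trans (by rw [natDegree_pow, natDegree_X_add_C, mul_one])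
  rw [natDegree_X_pow]
  omega

/-- Stray powers of `X` are absorbed by raising the formal degree, that is, by letting the binary
form vanish at infinity. -/
theorem riccatiTwist_add_natDegree (φ : F →+* F) (r : F) (e : ℕ) (p : F[X]) :
    riccatiTwist φ r (p.natDegree + e) p = X ^ e * riccatiTwist φ r p.natDegree p := by
  rw [riccatiTwist, show p.natDegree + e + 1 = (p.natDegree + 1) + e by ring,
    Finset.sum_range_add, riccatiTwist, Finset.mul_sum]
  rw [Finset.sum_eq_zero (s := Finset.range e), add_zero]
  · refine Finset.sum_congr rfl fun i hi => ?_
    have hi' : i ≤ p.natDegree := Nat.lt_succ_iff.1 (Finset.mem_range.1 hi)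
    rw [show p.natDegree + e - i = e + (p.natDegree - i) by omega, pow_add]
    ring
  · intro i _
    rw [coeff_eq_zero_of_natDegree_lt (by omega)]
    simp

/-- The binary form of degree `N` attached to a polynomial, with its coefficients mapped to an
overfield. -/
noncomputable def homogEval {L : Type*} [Field L] (ι : F →+* L) (N : ℕ) (p : F[X]) (a b : L) : L :=
  ∑ i ∈ Finset.range (N + 1), ι (p.coeff i) * a ^ i * b ^ (N - i)

theorem homogEval_riccatiTwist {L : Type*} [Field L] (ι : F →+* L) (φ : F →+* F) (r : F) (N : ℕ)
    (p : F[X]) (a b : L) :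
    homogEval ι N (riccatiTwist φ r N p) a b
      = homogEval (ι.comp φ) N p (a + ι r * b) a := by
  have hform : ∀ i ≤ N, ∑ j ∈ Finset.range (N + 1),
      ι (((X + C r) ^ i * X ^ (N - i)).coeff j) * a ^ j * b ^ (N - j)
        = (a + ι r * b) ^ i * a ^ (N - i) := by
    intro i hi
    obtain ⟨k, rfl⟩ := Nat.exists_eq_add_of_le hi
    rw [Nat.add_sub_cancel_left, show i + k + 1 = k + (i + 1) by ring, Finset.sum_range_add]
    have h1 : ∑ j ∈ Finset.range k,
        ι (((X + C r) ^ i * X ^ k).coeff j) * a ^ j * b ^ (i + k - j) = 0 := by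
      refine Finset.sum_eq_zero fun j hj => ?_
      rw [coeff_mul_X_pow', if_neg (by have := Finset.mem_range.1 hj; omega)]
      simp
    rw [h1, zero_add, add_pow a, Finset.sum_mul]
    refine Finset.sum_congr rfl fun j hj => ?_
    have hj' : j ≤ i := Nat.lt_succ_iff.1 (Finset.mem_range.1 hj)
    rw [add_comm k j, coeff_mul_X_pow, coeff_X_add_C_pow,
      show i + k - (j + k) = i - j by omega]
    simp only [map_mul, map_pow, map_natCast]
    ring
  have hc : ∀ j, (riccatiTwist φ r N p).coeff j = ∑ i ∈ Finset.range (N + 1),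
      φ (p.coeff i) * ((X + C r) ^ i * X ^ (N - i)).coeff j := by
    intro j
    rw [riccatiTwist, finsetSum_coeff]
    exact Finset.sum_congr rfl fun i _ => by rw [mul_assoc, coeff_C_mul]
  simp only [homogEval, hc, map_sum, Finset.sum_mul]
  rw [Finset.sum_comm]
  refine Finset.sum_congr rfl fun i hi => ?_
  rw [mul_assoc, ← hform i (Nat.lt_succ_iff.1 (Finset.mem_range.1 hi)), Finset.mul_sum]
  refine Finset.sum_congr rfl fun j _ => ?_
  simp only [map_mul, RingHom.comp_apply]
  ring

theorem homogEval_eq {L : Type*} [Field L] (ι : F →+* L) {N : ℕ} {p : F[X]} (hp : p.natDegree ≤ N)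
    (a : L) {b : L} (hb : b ≠ 0) : homogEval ι N p a b = b ^ N * p.eval₂ ι (a / b) := by
  rw [eval₂_eq_sum_range' ι (Nat.lt_succ_of_le hp), homogEval, Finset.mul_sum]
  refine Finset.sum_congr rfl fun i hi => ?_
  obtain ⟨k, rfl⟩ := Nat.exists_eq_add_of_le (Nat.lt_succ_iff.1 (Finset.mem_range.1 hi))
  rw [Nat.add_sub_cancel_left, div_pow, pow_add]
  field_simp

theorem homogEval_zero_right {L : Type*} [Field L] (ι : F →+* L) (N : ℕ) (p : F[X])
    (a : L) : homogEval ι N p a 0 = ι (p.coeff N) * a ^ N := by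
  rw [homogEval, Finset.sum_range_succ, Finset.sum_eq_zero]
  · simp
  · intro i hi
    have : N - i ≠ 0 := by have := Finset.mem_range.1 hi; omega
    simp [this]

theorem map_homogEval {L : Type*} [Field L] (ι : F →+* L) (σ : L →+* L) (N : ℕ) (p : F[X])
    (a b : L) : σ (homogEval ι N p a b) = homogEval (σ.comp ι) N p (σ a) (σ b) := by
  simp [homogEval]

theorem mobius_homogeneous {L : Type*} [Field L] {a b c d x y : L} (hy : y ≠ 0)
    (h : c * x + d * y ≠ 0) :
    (a * x + b * y) / (c * x + d * y) * (c * (x / y) + d) = a * (x / y) + b := by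
  rw [div_mul_eq_mul_div, div_eq_iff h]
  field_simp

/-- A sequence of projective points `w` with `A (w (k + 1)) = σ (w k)` satisfies
`A_i (w (k + i)) = σ ^ i (w k)`. -/
theorem transformProd_orbit {L : Type*} [Field L] [Algebra F L] {φ : F →+* F} {σ : L →+* L}
    (hσ : ∀ a, σ (algebraMap F L a) = algebraMap F L (φ a)) {r : F} {a b : ℕ → L}
    (h0 : ∀ k, a (k + 1) + algebraMap F L r * b (k + 1) = σ (a k))
    (h1 : ∀ k, a (k + 1) = σ (b k)) (i : ℕ) : ∀ k,
    algebraMap F L (transformProd φ !![1, r; 1, 0] i 0 0) * a (k + i)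
        + algebraMap F L (transformProd φ !![1, r; 1, 0] i 0 1) * b (k + i) = σ^[i] (a k) ∧
    algebraMap F L (transformProd φ !![1, r; 1, 0] i 1 0) * a (k + i)
        + algebraMap F L (transformProd φ !![1, r; 1, 0] i 1 1) * b (k + i) = σ^[i] (b k) := by
  have hit : ∀ i, σ^[i] (algebraMap F L r) = algebraMap F L (φ^[i] r) := by
    intro i
    induction i with
    | zero => rfl
    | succ i ih => rw [Function.iterate_succ_apply', ih, hσ, Function.iterate_succ_apply']
  induction i with
  | zero => intro k; simp [transformProd]
  | succ i ih =>
    intro k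
    obtain ⟨e0, e1⟩ := ih (k + 1)
    rw [show k + 1 + i = k + (i + 1) by ring] at e0 e1
    have hA : σ^[i + 1] (a k) = σ^[i] (a (k + 1)) + algebraMap F L (φ^[i] r) * σ^[i] (b (k + 1)) := by
      rw [Function.iterate_succ_apply, ← h0, iterate_map_add, iterate_map_mul, hit]
    have hB : σ^[i + 1] (b k) = σ^[i] (a (k + 1)) := by
      rw [Function.iterate_succ_apply, ← h1]
    rw [hA, hB, ← e0, ← e1]
    simp only [transformProd, Matrix.mul_apply, Fin.sum_univ_two, Matrix.map_apply,
      Matrix.of_apply, Matrix.cons_val', Matrix.cons_val_zero, Matrix.cons_val_one,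
      Matrix.cons_val_fin_one, iterate_map_one, iterate_map_zero, map_add, map_mul, map_one,
      map_zero]
    constructor <;> ring

/-- A binary form of positive degree that is semi-invariant under the Riccati transformation
yields an algebraic solution of some iterate of the Riccati equation. -/
theorem hasAlgebraicSolutionEq_of_riccatiTwist_eq {φ : F →+* F} {r : F} (hr : r ≠ 0) {N : ℕ}
    (hN : N ≠ 0) {q : F[X]} (hq : q ≠ 0) (hqN : q.natDegree ≤ N) {c : F}
    (h : q = C c * riccatiTwist φ r N q) :
    ∃ i, 1 ≤ i ∧ HasAlgebraicSolutionEq φ !![1, r; 1, 0] i := by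
  classical
  obtain ⟨σ, hσ⟩ := exists_ringHom_algebraicClosure_extending φ
  set L := AlgebraicClosure F
  set ι := algebraMap F L
  have hιφ : σ.comp ι = ι.comp φ := by ext a; exact hσ a
  have hr' : ι r ≠ 0 := by simpa [ι] using hr
  have hinv : ∀ a b : L, homogEval ι N q a b
      = ι c * homogEval (σ.comp ι) N q (a + ι r * b) a := by
    intro a b
    rw [hιφ, ← homogEval_riccatiTwist]
    conv_lhs => rw [h]
    simp only [homogEval, coeff_C_mul, map_mul, Finset.mul_sum, mul_assoc]
  -- a zero of the form
  obtain ⟨a₀, b₀, hne, hzero⟩ : ∃ a b : L, (a ≠ 0 ∨ b ≠ 0) ∧ homogEval ι N q a b = 0 := by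
    -- A constant `q` has formal degree `N > 0`, so its form vanishes at the point at infinity `(1 :
    -- 0)`.
    by_cases hd : q.natDegree = 0
    · refine ⟨1, 0, Or.inl one_ne_zero, ?_⟩
      rw [homogEval_zero_right, coeff_eq_zero_of_natDegree_lt (by omega)]
      simp
    · obtain ⟨x, hx⟩ := IsAlgClosed.exists_aeval_eq_zero L q
        (fun h' => hd (natDegree_eq_of_degree_eq_some h'))
      refine ⟨x, 1, Or.inr one_ne_zero, ?_⟩
      rw [homogEval_eq ι hqN x one_ne_zero, div_one]
      rw [aeval_def] at hx
      simp [ι, hx]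
  -- The orbit of the zero under `z ↦ A⁻¹ σ(z)` in homogeneous coordinates.
  let w : ℕ → L × L := fun k =>
    (fun z : L × L => (σ z.2, (σ z.1 - σ z.2) / ι r))^[k] (a₀, b₀)
  have hw : ∀ k, w (k + 1) = (σ (w k).2, (σ (w k).1 - σ (w k).2) / ι r) := fun k => by
    simp only [w, Function.iterate_succ_apply']
  have h0 : ∀ k, (w (k + 1)).1 + ι r * (w (k + 1)).2 = σ (w k).1 := by
    intro k; rw [hw, mul_div_cancel₀ _ hr']; ring
  have h1 : ∀ k, (w (k + 1)).1 = σ (w k).2 := by intro k; rw [hw]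
  have hwne : ∀ k, (w k).1 ≠ 0 ∨ (w k).2 ≠ 0 := by
    intro k
    induction k with
    | zero => exact hne
    | succ k ih =>
      by_contra! hcon
      have e1 := h1 k
      have e0 := h0 k
      rw [hcon.1] at e1 e0
      rw [hcon.2] at e0
      have f1 : (w k).1 = 0 := (map_eq_zero σ).1 (by rw [← e0]; ring)
      have f2 : (w k).2 = 0 := (map_eq_zero σ).1 e1.symm
      rcases ih with ih | ih
      · exact ih f1
      · exact ih f2
  have hwz : ∀ k, homogEval ι N q (w k).1 (w k).2 = 0 := by
    intro k
    induction k with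
    | zero => exact hzero
    | succ k ih => rw [hinv, h0, h1, ← map_homogEval, ih, map_zero, mul_zero]
  -- pigeonhole on the projective zeros
  let S : Finset L := insert 0 (q.aroots L).toFinset
  have hmem : ∀ k, (w k).1 / (w k).2 ∈ S := by
    intro k
    by_cases hb : (w k).2 = 0
    · simp [S, hb]
    · have h2 := hwz k
      rw [homogEval_eq ι hqN _ hb] at h2
      have h3 := (mul_eq_zero.1 h2).resolve_left (pow_ne_zero _ hb)
      refine Finset.mem_insert_of_mem (Multiset.mem_toFinset.2 ?_)
      rw [mem_aroots]
      exact ⟨hq, by rw [aeval_def]; exact h3⟩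
  -- Since `x / 0 = 0`, the points `(1 : 0)` and `(0 : 1)` have the same quotient; the Boolean
  -- separates them.
  obtain ⟨k, l, hkl, heq⟩ := Finite.exists_ne_map_eq_of_infinite
    (fun k => ((⟨(w k).1 / (w k).2, hmem k⟩ : S), decide ((w k).2 = 0)))
  wlog hlt : k < l generalizing k l
  · exact this l k hkl.symm heq.symm (by omega)
  simp only [Prod.mk.injEq, Subtype.mk.injEq, decide_eq_decide] at heq
  obtain ⟨hdiv, hiff⟩ := heq
  obtain ⟨i, rfl⟩ := Nat.exists_eq_add_of_lt hlt
  have horb := transformProd_orbit (L := L) (a := fun k => (w k).1)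
    (b := fun k => (w k).2) hσ h0 h1 (i + 1)
  refine ⟨i + 1, by omega, ?_⟩
  -- If the recurring point is at infinity, its successor is `(0 : 1)`, which recurs with the same
  -- period and gives the solution `0`.
  by_cases hb : (w k).2 = 0
  · have hb' := hiff.1 hb
    have e := horb (k + 1)
    have f1 : (w (k + 1)).1 = 0 := by rw [h1, hb, map_zero]
    have f2 : (w (k + 1 + (i + 1))).1 = 0 := by
      rw [show k + 1 + (i + 1) = (k + i + 1) + 1 by ring, h1, hb', map_zero]
    have g2 : (w (k + 1 + (i + 1))).2 ≠ 0 := (hwne _).resolve_left (not_not.2 f2)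
    refine ⟨L, inferInstance, inferInstance, σ, 0, hσ, isAlgebraic_zero, ?_⟩
    have e0 := e.1
    rw [f1, f2, iterate_map_zero, mul_zero, zero_add] at e0
    have e0' := (mul_eq_zero.1 e0).resolve_right g2
    simp only [IsSolutionEq, iterate_map_zero, mul_zero, zero_mul, zero_add]
    exact e0'.symm
  · have hb' : (w (k + i + 1)).2 ≠ 0 := fun h' => hb (hiff.2 h')
    have e := horb k
    refine ⟨L, inferInstance, inferInstance, σ, (w k).1 / (w k).2, hσ,
      Algebra.IsAlgebraic.isAlgebraic _, ?_⟩
    obtain ⟨e0, e1⟩ := e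
    rw [← add_assoc] at e0 e1
    have hσb : σ^[i + 1] (w k).2 ≠ 0 := by
      intro h'
      exact hb ((σ.injective.iterate (i + 1)) (by rw [h', iterate_map_zero]))
    have hdivσ : σ^[i + 1] ((w k).1 / (w k).2) = σ^[i + 1] (w k).1 / σ^[i + 1] (w k).2 := by
      rw [eq_div_iff hσb, ← iterate_map_mul, div_mul_cancel₀ _ hb]
    unfold IsSolutionEq
    rw [hdivσ, ← e0, ← e1]
    rw [← e1] at hσb
    rw [hdiv]
    exact mobius_homogeneous hb' hσb

end RiccatiTwist

/-! ### Difference equations in the rational function field `F(f)`. -/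

section RiccatiRational

variable {F : Type u} {U : Type v} [Field F] [Field U] [Algebra F U]

theorem exists_isCoprime_aeval_div {t y : U} (htr : Transcendental F t)
    (hy : ∃ p q : F[X], y = aeval t p / aeval t q) :
    ∃ p q : F[X], IsCoprime p q ∧ q ≠ 0 ∧ aeval t q ≠ 0 ∧ y = aeval t p / aeval t q := by
  classical
  obtain ⟨p, q, rfl⟩ := hy
  have hinj := aeval_injective_of_transcendental htr
  by_cases hq : q = 0
  -- A zero denominator makes the quotient `0` by convention.
  · exact ⟨0, 1, isCoprime_one_right, one_ne_zero, by simp, by simp [hq]⟩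
  have hg : EuclideanDomain.gcd p q ≠ 0 := fun h => hq (EuclideanDomain.gcd_eq_zero_iff.1 h).2
  obtain ⟨p', hp'⟩ := EuclideanDomain.gcd_dvd_left p q
  obtain ⟨q', hq'⟩ := EuclideanDomain.gcd_dvd_right p q
  have hq'0 : q' ≠ 0 := by rintro rfl; exact hq (by rw [hq', mul_zero])
  have hne : ∀ {a : F[X]}, a ≠ 0 → aeval t a ≠ 0 := fun ha h => ha (hinj (by simpa using h))
  refine ⟨p', q', ?_, hq'0, hne hq'0, ?_⟩
  · refine ⟨EuclideanDomain.gcdA p q, EuclideanDomain.gcdB p q, mul_left_cancel₀ hg ?_⟩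
    have := EuclideanDomain.gcd_eq_gcd_ab p q
    linear_combination (-EuclideanDomain.gcdA p q) * hp' - (EuclideanDomain.gcdB p q) * hq' - this
  · have ep := congrArg (aeval t) hp'
    have eq := congrArg (aeval t) hq'
    rw [map_mul] at ep eq
    rw [ep, eq, mul_div_mul_left _ _ (hne hg)]

variable {φ : F →+* F} {τ : U →+* U} {r : F} {f : U}

theorem ne_zero_of_riccati (hr : r ≠ 0) (hf : τ f * f = f + algebraMap F U r) : f ≠ 0 := by
  rintro rfl
  exact hr (by simpa using hf.symm)

theorem coeff_zero_riccatiTwist_ne_zero (hr : r ≠ 0) {p : F[X]} (hp : p ≠ 0) :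
    (riccatiTwist φ r p.natDegree p).coeff 0 ≠ 0 := by
  rw [coeff_zero_riccatiTwist]
  exact mul_ne_zero (by simpa using hp) (pow_ne_zero _ hr)

theorem riccatiTwist_ne_zero (hr : r ≠ 0) {p : F[X]} (hp : p ≠ 0) :
    riccatiTwist φ r p.natDegree p ≠ 0 := fun h =>
  coeff_zero_riccatiTwist_ne_zero (φ := φ) hr hp (by simp [h])

theorem isCoprime_riccatiTwist_X_pow (hr : r ≠ 0) {p : F[X]} (hp : p ≠ 0) (n : ℕ) :
    IsCoprime (riccatiTwist φ r p.natDegree p) (X ^ n) := by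
  refine IsCoprime.pow_right ?_
  rw [isCoprime_comm, (prime_X : Prime (X : F[X])).irreducible.coprime_iff_not_dvd, X_dvd_iff]
  exact coeff_zero_riccatiTwist_ne_zero hr hp

/-- The minimal polynomial of `f` divides its own twist, whose degree is no larger; it would be a
semi-invariant form. -/
theorem transcendental_of_riccati
    (hφ : ∀ a, τ (algebraMap F U a) = algebraMap F U (φ a)) (hr : r ≠ 0)
    (hf : τ f * f = f + algebraMap F U r)
    (hA : ∀ i : ℕ, 1 ≤ i → ¬ HasAlgebraicSolutionEq φ !![1, r; 1, 0] i) :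
    Transcendental F f := by
  intro halg
  have hint := halg.isIntegral
  have hne := minpoly.ne_zero hint
  have hd : minpoly F f ∣ riccatiTwist φ r (minpoly F f).natDegree (minpoly F f) := by
    apply minpoly.dvd
    rw [aeval_riccatiTwist hφ hf le_rfl, minpoly.aeval, map_zero, mul_zero]
  obtain ⟨w, hw⟩ := hd
  have hw0 : w ≠ 0 := by
    rintro rfl
    exact riccatiTwist_ne_zero (φ := φ) hr hne (by rw [hw, mul_zero])
  have hdeg := natDegree_riccatiTwist_le φ r (minpoly F f).natDegree (minpoly F f)
  rw [hw, natDegree_mul hne hw0] at hdeg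
  obtain ⟨c, rfl⟩ := natDegree_eq_zero.1 (show w.natDegree = 0 by omega)
  have hc : c ≠ 0 := by rintro rfl; simp at hw0
  obtain ⟨i, hi, h⟩ := hasAlgebraicSolutionEq_of_riccatiTwist_eq (c := c⁻¹) hr
    (minpoly.natDegree_pos hint).ne' hne le_rfl (by
      rw [hw, mul_comm _ (C c), ← mul_assoc, ← C_mul, inv_mul_cancel₀ hc, C_1, one_mul])
  exact hA i hi h

/-- A polynomial whose twist agrees with it up to powers of `X` is constant. -/
theorem natDegree_eq_zero_of_riccatiTwist_dvd (hr : r ≠ 0)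
    (hA : ∀ i : ℕ, 1 ≤ i → ¬ HasAlgebraicSolutionEq φ !![1, r; 1, 0] i)
    {q : F[X]} (hq : q ≠ 0) {n : ℕ}
    (h₁ : riccatiTwist φ r q.natDegree q ∣ q)
    (h₂ : q ∣ X ^ n * riccatiTwist φ r q.natDegree q) : q.natDegree = 0 := by
  have hne := riccatiTwist_ne_zero (φ := φ) hr hq
  obtain ⟨w, hw⟩ := h₁
  have hwX : w ∣ X ^ n := by
    refine (mul_dvd_mul_iff_right hne).1 ?_
    rw [mul_comm, ← hw]
    exact h₂
  -- The cofactor is `c X^e`, so `q` is semi-invariant as a form of degree `q.natDegree + e`.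
  obtain ⟨e, -, v, hv⟩ := (dvd_prime_pow prime_X n).1 hwX
  obtain ⟨c, -, hc⟩ := Polynomial.isUnit_iff.1 (v⁻¹).isUnit
  have hw' : w = C c * X ^ e := by rw [hc, ← hv, mul_comm, mul_assoc, Units.mul_inv, mul_one]
  by_contra hd
  obtain ⟨i, hi, h⟩ := hasAlgebraicSolutionEq_of_riccatiTwist_eq (φ := φ) (c := c)
    (N := q.natDegree + e) hr (by omega) hq (by omega) (by
      rw [riccatiTwist_add_natDegree, ← mul_assoc, ← hw', mul_comm]
      exact hw)
  exact hA i hi h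

/-- Twisting a Bézout identity and clearing powers of `f` yields a combination equal to a power of
`X`, to which the twist of `q` is prime. -/
theorem isCoprime_riccatiTwist
    (hφ : ∀ a, τ (algebraMap F U a) = algebraMap F U (φ a)) (hr : r ≠ 0)
    (hf : τ f * f = f + algebraMap F U r)
    (htr : Transcendental F f) {p q : F[X]} (hpq : IsCoprime p q)
    (hq : q ≠ 0) :
    IsCoprime (riccatiTwist φ r q.natDegree q) (riccatiTwist φ r p.natDegree p) := by
  obtain ⟨a, b, hab⟩ := hpq
  have key : X ^ (b.natDegree + q.natDegree) * riccatiTwist φ r a.natDegree a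
        * riccatiTwist φ r p.natDegree p
      + X ^ (a.natDegree + p.natDegree) * riccatiTwist φ r b.natDegree b
        * riccatiTwist φ r q.natDegree q
      = X ^ (a.natDegree + p.natDegree + b.natDegree + q.natDegree) := by
    apply aeval_injective_of_transcendental htr
    have h1 := congrArg (fun x => τ (aeval f x)) hab
    simp only [map_add, map_mul, map_one] at h1
    simp only [map_add, map_mul, map_pow, aeval_X, aeval_riccatiTwist hφ hf le_rfl]
    linear_combination f ^ (a.natDegree + p.natDegree + b.natDegree + q.natDegree) * h1
  have h2 := isCoprime_riccatiTwist_X_pow (φ := φ) hr hq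
    (a.natDegree + p.natDegree + b.natDegree + q.natDegree)
  rw [← key] at h2
  exact h2.of_add_mul_right_right.of_mul_right_right

/-- The field `F(f)` contains no nonzero semi-invariant of nonzero weight. -/
theorem eq_zero_of_semiinvariant
    (hφ : ∀ a, τ (algebraMap F U a) = algebraMap F U (φ a)) (hr : r ≠ 0)
    (hf : τ f * f = f + algebraMap F U r)
    (hA : ∀ i : ℕ, 1 ≤ i → ¬ HasAlgebraicSolutionEq φ !![1, r; 1, 0] i)
    {y : U} (hy : ∃ p q : F[X], y = aeval f p / aeval f q) {c : F} {k : ℕ} (hk : k ≠ 0)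
    (hyτ : τ y = algebraMap F U c * f ^ (2 * k) * y) : y = 0 := by
  have htr := transcendental_of_riccati hφ hr hf hA
  have hinj := aeval_injective_of_transcendental htr
  have hf0 := ne_zero_of_riccati hr hf
  obtain ⟨p, q, hpq, hq, hqf, rfl⟩ := exists_isCoprime_aeval_div htr hy
  by_contra hne
  have hp : p ≠ 0 := by rintro rfl; simp at hne
  have hτq : τ (aeval f q) ≠ 0 := by simpa using hqf
  have key : riccatiTwist φ r p.natDegree p * q * X ^ q.natDegree
      = C c * X ^ (2 * k + p.natDegree) * p * riccatiTwist φ r q.natDegree q := by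
    apply hinj
    rw [map_div₀] at hyτ
    simp only [map_mul, map_pow, aeval_X, aeval_C, aeval_riccatiTwist hφ hf le_rfl]
    field_simp at hyτ
    linear_combination f ^ (p.natDegree + q.natDegree) * hyτ
  have hcop := isCoprime_riccatiTwist hφ hr hf htr hpq hq
  have h1 : riccatiTwist φ r q.natDegree q ∣ q := by
    refine (isCoprime_riccatiTwist_X_pow hr hq q.natDegree).dvd_of_dvd_mul_right ?_
    refine hcop.dvd_of_dvd_mul_left ?_
    rw [← mul_assoc, key]
    exact dvd_mul_left _ _
  have h2 : q ∣ X ^ (2 * k + p.natDegree) * riccatiTwist φ r q.natDegree q := by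
    have hc : c ≠ 0 := by
      rintro rfl
      have : riccatiTwist φ r p.natDegree p * q * X ^ q.natDegree = 0 := by rw [key]; simp
      exact mul_ne_zero (mul_ne_zero (riccatiTwist_ne_zero hr hp) hq)
        (pow_ne_zero _ X_ne_zero) this
    refine hpq.symm.dvd_of_dvd_mul_left ?_
    rw [← (isUnit_C.2 hc.isUnit).dvd_mul_left]
    refine Dvd.intro_left (riccatiTwist φ r p.natDegree p * X ^ q.natDegree) ?_
    linear_combination key
  have hd := natDegree_eq_zero_of_riccatiTwist_dvd hr hA hq h1 h2
  obtain ⟨b, rfl⟩ := natDegree_eq_zero.1 hd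
  -- With `q` constant, the left side has nonzero constant term, while `k ≠ 0` puts a factor `X` on
  -- the right.
  have h3 := congrArg (coeff · 0) key
  have hexp : 2 * k + p.natDegree ≠ 0 := by omega
  simp only [mul_coeff_zero, natDegree_C, pow_zero, coeff_C_zero, mul_one,
    coeff_X_pow, hexp.symm, if_false, mul_zero, zero_mul] at h3
  refine mul_ne_zero (coeff_zero_riccatiTwist_ne_zero hr hp) ?_ h3
  rintro rfl
  simp at hq

/-- The line carries no connection invariant under the Riccati transformation. -/
theorem riccati_no_invariant_connection
    (hφ : ∀ a, τ (algebraMap F U a) = algebraMap F U (φ a)) (hr : r ≠ 0)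
    (hf : τ f * f = f + algebraMap F U r)
    (hA : ∀ i : ℕ, 1 ≤ i → ¬ HasAlgebraicSolutionEq φ !![1, r; 1, 0] i)
    {y : U} (hy : ∃ p q : F[X], y = aeval f p / aeval f q) {κ : F} (hκ : κ ≠ 0) :
    algebraMap F U (-r) / f ^ 2 * τ y ≠ y - algebraMap F U κ / f := by
  intro hyτ
  have htr := transcendental_of_riccati hφ hr hf hA
  have hinj := aeval_injective_of_transcendental htr
  have hf0 := ne_zero_of_riccati hr hf
  obtain ⟨p, q, hpq, hq, hqf, rfl⟩ := exists_isCoprime_aeval_div htr hy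
  have hτq : τ (aeval f q) ≠ 0 := by simpa using hqf
  have key : C (-r) * riccatiTwist φ r p.natDegree p * q * X ^ q.natDegree
      = X ^ (p.natDegree + 1) * (p * X - C κ * q) * riccatiTwist φ r q.natDegree q := by
    apply hinj
    rw [map_div₀] at hyτ
    simp only [map_mul, map_pow, map_sub, aeval_X, aeval_C, aeval_riccatiTwist hφ hf le_rfl]
    field_simp at hyτ
    linear_combination f ^ (p.natDegree + q.natDegree) * hyτ
  have hcop := isCoprime_riccatiTwist hφ hr hf htr hpq hq
  have hru : IsUnit (C (-r)) := isUnit_C.2 (neg_ne_zero.2 hr).isUnit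
  have h1 : riccatiTwist φ r q.natDegree q ∣ q := by
    refine (isCoprime_riccatiTwist_X_pow hr hq q.natDegree).dvd_of_dvd_mul_right ?_
    refine hcop.dvd_of_dvd_mul_left ?_
    rw [← hru.dvd_mul_left, ← mul_assoc, ← mul_assoc, key]
    exact dvd_mul_left _ _
  have h2 : q ∣ X ^ (p.natDegree + 2) * riccatiTwist φ r q.natDegree q := by
    refine hpq.symm.dvd_of_dvd_mul_left ?_
    refine Dvd.intro_left (C (-r) * riccatiTwist φ r p.natDegree p * X ^ q.natDegree
      + X ^ (p.natDegree + 1) * C κ * riccatiTwist φ r q.natDegree q) ?_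
    linear_combination key
  have hd := natDegree_eq_zero_of_riccatiTwist_dvd hr hA hq h1 h2
  obtain ⟨b, rfl⟩ := natDegree_eq_zero.1 hd
  have hb : b ≠ 0 := by rintro rfl; simp at hq
  have hp : p = 0 := by
    by_contra hp
    have h3 := congrArg (coeff · 0) key
    have hexp : p.natDegree + 1 ≠ 0 := by omega
    simp only [mul_coeff_zero, natDegree_C, pow_zero, coeff_C_zero, mul_one,
      coeff_X_pow, hexp.symm, if_false, zero_mul] at h3
    exact mul_ne_zero (mul_ne_zero (neg_ne_zero.2 hr)
      (coeff_zero_riccatiTwist_ne_zero hr hp)) hb h3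
  subst hp
  simp only [map_zero, zero_div, mul_zero, zero_sub, zero_eq_neg] at hyτ
  exact div_ne_zero (by simpa using hκ) hf0 hyτ

/-- A rational solution of the equation satisfied by the derivative of `f` is a quadratic
polynomial, whose leading coefficient solves a third order linear difference equation. -/
theorem exists_third_order_solution
    (hφ : ∀ a, τ (algebraMap F U a) = algebraMap F U (φ a)) (hr : r ≠ 0)
    (hf : τ f * f = f + algebraMap F U r)
    (hA : ∀ i : ℕ, 1 ≤ i → ¬ HasAlgebraicSolutionEq φ !![1, r; 1, 0] i)
    {s r' : F} (hs : s ≠ 0) {z : U} (hz : ∃ p q : F[X], z = aeval f p / aeval f q)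
    (hzτ : algebraMap F U s * τ z
      = - algebraMap F U r / f ^ 2 * z + algebraMap F U r' / f) :
    ∃ g : F, φ^[2] (s * r) * φ s * s * φ^[3] g + (φ r + 1) * φ s * s * φ^[2] g
        - (φ r + 1) * s * φ g - r * g + s * φ (r' / r) = 0 := by
  have htr := transcendental_of_riccati hφ hr hf hA
  have hinj := aeval_injective_of_transcendental htr
  have hf0 := ne_zero_of_riccati hr hf
  obtain ⟨P, rfl⟩ : ∃ P : F[X], z = aeval f P := by
    obtain ⟨p, q, hpq, hq, hqf, rfl⟩ := exists_isCoprime_aeval_div htr hz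
    have hτq : τ (aeval f q) ≠ 0 := by simpa using hqf
    have key : C s * X ^ 2 * riccatiTwist φ r p.natDegree p * q * X ^ q.natDegree
        = X ^ p.natDegree * (C r' * X * q - C r * p) * riccatiTwist φ r q.natDegree q := by
      apply hinj
      rw [map_div₀] at hzτ
      simp only [map_mul, map_pow, map_sub, aeval_X, aeval_C, aeval_riccatiTwist hφ hf le_rfl]
      field_simp at hzτ
      linear_combination f ^ (p.natDegree + q.natDegree) * hzτ
    have hcop := isCoprime_riccatiTwist hφ hr hf htr hpq hq
    have hru : IsUnit (C r) := isUnit_C.2 hr.isUnit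
    have hsu : IsUnit (C s) := isUnit_C.2 hs.isUnit
    have h1 : riccatiTwist φ r q.natDegree q ∣ q := by
      refine (isCoprime_riccatiTwist_X_pow hr hq q.natDegree).dvd_of_dvd_mul_right ?_
      refine hcop.dvd_of_dvd_mul_left ?_
      refine (isCoprime_riccatiTwist_X_pow hr hq 2).dvd_of_dvd_mul_left ?_
      rw [← hsu.dvd_mul_left, ← mul_assoc, ← mul_assoc, ← mul_assoc, key]
      exact dvd_mul_left _ _
    have h2 : q ∣ X ^ p.natDegree * riccatiTwist φ r q.natDegree q := by
      refine hpq.symm.dvd_of_dvd_mul_left ?_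
      rw [← hru.dvd_mul_left]
      refine Dvd.intro_left (X ^ p.natDegree * C r' * X * riccatiTwist φ r q.natDegree q
        - C s * X ^ 2 * riccatiTwist φ r p.natDegree p * X ^ q.natDegree) ?_
      linear_combination - key
    have hd := natDegree_eq_zero_of_riccatiTwist_dvd hr hA hq h1 h2
    obtain ⟨b, rfl⟩ := natDegree_eq_zero.1 hd
    refine ⟨C b⁻¹ * p, ?_⟩
    rw [aeval_C, map_mul, aeval_C, map_inv₀, div_eq_inv_mul]
  have hP : P.natDegree ≤ 2 := by
    by_contra! hlt
    have key : C s * riccatiTwist φ r P.natDegree P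
        = X ^ (P.natDegree - 2) * (C r' * X - C r * P) := by
      apply hinj
      obtain ⟨e, he⟩ := Nat.exists_eq_add_of_le hlt.le
      simp only [map_mul, map_pow, map_sub, aeval_X, aeval_C, aeval_riccatiTwist hφ hf le_rfl]
      rw [he, Nat.add_sub_cancel_left]
      field_simp at hzτ
      linear_combination f ^ e * hzτ
    -- Beyond degree 2 the right side is divisible by `X`, the twist on the left is not.
    have h3 := congrArg (coeff · 0) key
    have hexp : P.natDegree - 2 ≠ 0 := by omega
    simp only [mul_coeff_zero, coeff_C_zero, coeff_X_pow, hexp.symm, if_false, zero_mul] at h3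
    refine mul_ne_zero hs (coeff_zero_riccatiTwist_ne_zero hr ?_) h3
    rintro rfl
    simp at hlt
  have key : C s * riccatiTwist φ r 2 P = C r' * X - C r * P := by
    apply hinj
    simp only [map_mul, map_sub, aeval_X, aeval_C, aeval_riccatiTwist hφ hf hP]
    field_simp at hzτ
    linear_combination hzτ
  have htw : riccatiTwist φ r 2 P = C (φ (P.coeff 2) * r ^ 2)
      + C (φ (P.coeff 1) * r + 2 * φ (P.coeff 2) * r) * X
      + C (φ (P.coeff 0) + φ (P.coeff 1) + φ (P.coeff 2)) * X ^ 2 := by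
    simp only [riccatiTwist, Finset.sum_range_succ, Finset.sum_range_zero, C_add, C_mul, C_pow,
      map_ofNat]
    ring
  have hcoeff : ∀ (a b c : F) (n : ℕ), (C s * (C a + C b * X + C c * X ^ 2)).coeff n
      = s * ((if n = 0 then a else 0) + (if n = 1 then b else 0) + if n = 2 then c else 0) := by
    intro a b c n
    simp only [coeff_C_mul, coeff_add, coeff_C, coeff_X, coeff_X_pow, eq_comm (a := 1)]
    simp
  rw [htw] at key
  have c0 := congrArg (coeff · 0) key
  have c1 := congrArg (coeff · 1) key
  have c2 := congrArg (coeff · 2) key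
  simp only [hcoeff] at c0 c1 c2
  simp [coeff_X] at c0 c1 c2
  generalize P.coeff 0 = p0 at c0 c1 c2
  generalize P.coeff 1 = p1 at c0 c1 c2
  generalize P.coeff 2 = p2 at c0 c1 c2
  -- The three coefficient identities express `p0` and `p1` through `p2`; the remaining one becomes
  -- the third order equation for `-p2`.
  have e0 : p0 = - s * r * φ p2 := by
    apply mul_left_cancel₀ hr
    linear_combination c0
  have e1 : p1 = r' / r + r * p2 - s * φ p2 + s * φ p0 := by
    field_simp
    linear_combination c1 - r * c2
  have d0 := congrArg φ e0
  have d1 := congrArg φ e1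
  have d00 := congrArg φ d0
  simp only [map_add, map_sub, map_mul, map_neg] at d0 d1 d00
  refine ⟨-p2, ?_⟩
  simp only [Function.iterate_succ_apply, Function.iterate_zero_apply, map_neg, map_mul]
  linear_combination - s * d1 + c2 - s * φ s * d00 - s * d0

end RiccatiRational

/-! ### The tower generated by the derivatives of `f`, and the action of `D` and `τ` on it. -/

section Jets

variable {F : Type u} {U : Type v} [Field F] [Field U] [Algebra F U]

/-- The field `F(f, Df, …, D^(j-1) f)`. -/
def jetField (F : Type u) {U : Type v} [Field F] [Field U] [Algebra F U] (D : Derivation ℤ U U)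
    (f : U) (j : ℕ) : IntermediateField F U :=
  IntermediateField.adjoin F ((fun i => D^[i] f) '' Set.Iio j)

variable {D : Derivation ℤ U U} {f : U}

theorem iterate_mem_jetField {i j : ℕ} (h : i < j) : D^[i] f ∈ jetField F D f j :=
  IntermediateField.subset_adjoin _ _ ⟨i, h, rfl⟩

theorem self_mem_jetField {j : ℕ} (h : 0 < j) : f ∈ jetField F D f j :=
  iterate_mem_jetField (i := 0) h

theorem jetField_mono {i j : ℕ} (h : i ≤ j) : jetField F D f i ≤ jetField F D f j :=
  IntermediateField.adjoin.mono _ _ _ (Set.image_mono (Set.Iio_subset_Iio h))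

theorem exists_aeval_div_of_mem_jetField_succ {j : ℕ} {y : U} (hy : y ∈ jetField F D f (j + 1)) :
    ∃ p q : (jetField F D f j)[X], y = aeval (D^[j] f) p / aeval (D^[j] f) q := by
  rw [← IntermediateField.mem_adjoin_simple_iff]
  have h : (fun i => D^[i] f) '' Set.Iio (j + 1)
      = (fun i => D^[i] f) '' Set.Iio j ∪ {D^[j] f} := by
    rw [← Set.image_singleton (f := fun i => D^[i] f), ← Set.image_union]
    congr 1
    ext i
    simp only [Set.mem_Iio, Set.mem_union, Set.mem_singleton_iff]
    omega
  rw [jetField, h, ← IntermediateField.adjoin_adjoin_left] at hy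
  exact hy

theorem exists_aeval_div_of_mem_jetField_one {y : U} (hy : y ∈ jetField F D f 1) :
    ∃ p q : F[X], y = aeval f p / aeval f q := by
  rw [← IntermediateField.mem_adjoin_simple_iff]
  have h : (fun i => D^[i] f) '' Set.Iio 1 = {f} := by
    ext x; simp [eq_comm]
  rwa [jetField, h] at hy

/-- For a differentially algebraic element the transcendental steps of the jet tower stop. -/
theorem exists_isAlgebraic_jetField (hf : IsDifferentiallyAlgebraic F D f) :
    ∃ n, IsAlgebraic (jetField F D f n) (D^[n] f) := by
  by_contra! hcon
  -- If no step were algebraic, all the derivatives would be algebraically independent,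
  -- contradicting finite transcendence degree.
  have hind : ∀ n, AlgebraicIndepOn F (fun i => D^[i] f) (Set.Iio n) := by
    intro n
    induction n with
    | zero =>
      rw [show Set.Iio 0 = (∅ : Set ℕ) by ext; simp]
      exact algebraicIndependent_empty_type_iff.2 (algebraMap F U).injective
    | succ n ih =>
      rw [show Set.Iio (n + 1) = insert n (Set.Iio n) by ext; simp]
      refine ih.insert ?_
      have hle : Algebra.adjoin F ((fun i => D^[i] f) '' Set.Iio n)
          ≤ (jetField F D f n).toSubalgebra := IntermediateField.algebra_adjoin_le_adjoin _ _
      exact Transcendental.of_tower_top_of_subalgebra_le hle (hcon n)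
  set E := IntermediateField.adjoin F (Set.range fun n : ℕ => D^[n] f)
  let x : ℕ → E := fun n => ⟨D^[n] f, IntermediateField.subset_adjoin _ _ ⟨n, rfl⟩⟩
  refine not_le.2 hf (Cardinal.aleph0_le.2 fun n => ?_)
  have h1 : AlgebraicIndependent F (fun i : Set.Iio n => x i) :=
    AlgebraicIndependent.of_comp E.val (hind n)
  have h2 := h1.lift_cardinalMk_le_trdeg
  simpa using h2

variable {D₀ : Derivation ℤ F F} {φ : F →+* F} {τ : U →+* U} {s r : F}

theorem derivation_mem_jetField_succ (hD : ∀ a, D (algebraMap F U a) = algebraMap F U (D₀ a))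
    {j : ℕ} {y : U} (hy : y ∈ jetField F D f j) : D y ∈ jetField F D f (j + 1) := by
  have hle : ∀ {x}, x ∈ jetField F D f j → x ∈ jetField F D f (j + 1) :=
    fun h => jetField_mono (Nat.le_succ j) h
  induction hy using IntermediateField.adjoin_induction with
  | mem x hx =>
    obtain ⟨i, hi, rfl⟩ := hx
    change D (D^[i] f) ∈ _
    rw [← Function.iterate_succ_apply' (f := D)]
    exact iterate_mem_jetField (Nat.succ_lt_succ hi)
  | algebraMap a => rw [hD]; exact algebraMap_mem _ _
  | add x y hx hy ihx ihy => rw [map_add]; exact add_mem ihx ihy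
  | inv x hx ih =>
    rw [Derivation.leibniz_inv, smul_eq_mul]
    exact mul_mem (neg_mem (pow_mem (inv_mem (hle hx)) 2)) ih
  | mul x y hx hy ihx ihy =>
    rw [Derivation.leibniz, smul_eq_mul, smul_eq_mul]
    exact add_mem (mul_mem (hle hx) ihy) (mul_mem (hle hy) ihx)

/-- The hypotheses on a solution `f` of the Riccati equation `τ(f) f = f + r` in a field with
a derivation and an endomorphism. -/
structure RiccatiSolution (D₀ : Derivation ℤ F F) (φ : F →+* F) (s r : F)
    (D : Derivation ℤ U U) (τ : U →+* U) (f : U) : Prop where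
  derivation_algebraMap : ∀ a, D (algebraMap F U a) = algebraMap F U (D₀ a)
  map_algebraMap : ∀ a, τ (algebraMap F U a) = algebraMap F U (φ a)
  derivation_map : ∀ x, D (τ x) = algebraMap F U s * τ (D x)
  s_ne_zero : s ≠ 0
  r_ne_zero : r ≠ 0
  riccati : τ f * f = f + algebraMap F U r
  no_algebraic : ∀ i : ℕ, 1 ≤ i → ¬ HasAlgebraicSolutionEq φ !![1, r; 1, 0] i

namespace RiccatiSolution

theorem quadratic_mem_intermediateField {M : IntermediateField F U} {x y δ : U} (e r : F)
    (hx : x ∈ M) (hy : y ∈ M) (hδ : δ ∈ M) :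
    2 * algebraMap F U r / x ^ 3 * y ^ 2 + algebraMap F U e * algebraMap F U r / x ^ 2 * y + δ
      ∈ M :=
  add_mem (add_mem (mul_mem (div_mem (mul_mem (ofNat_mem M 2) (algebraMap_mem M r))
    (pow_mem hx 3)) (pow_mem hy 2)) (mul_mem (div_mem (mul_mem (algebraMap_mem M e)
    (algebraMap_mem M r)) (pow_mem hx 2)) hy)) hδ

theorem linear_coeff_mem_intermediateField {M : IntermediateField F U} {x y : U} (n : ℕ) (e r : F)
    (hx : x ∈ M) (hy : y ∈ M) :
    2 * (n + 3) * algebraMap F U r * y / x ^ 3 + algebraMap F U e * algebraMap F U r / x ^ 2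
      ∈ M :=
  add_mem (div_mem (mul_mem (mul_mem (mul_mem (ofNat_mem M 2) (add_mem (natCast_mem M n)
    (ofNat_mem M 3))) (algebraMap_mem M r)) hy) (pow_mem hx 3))
    (div_mem (mul_mem (algebraMap_mem M e) (algebraMap_mem M r)) (pow_mem hx 2))

theorem ne_zero (h : RiccatiSolution D₀ φ s r D τ f) : f ≠ 0 :=
  ne_zero_of_riccati h.r_ne_zero h.riccati

theorem algebraMap_s_ne_zero (h : RiccatiSolution D₀ φ s r D τ f) : algebraMap F U s ≠ 0 := by
  simpa using h.s_ne_zero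

theorem algebraMap_r_ne_zero (h : RiccatiSolution D₀ φ s r D τ f) : algebraMap F U r ≠ 0 := by
  simpa using h.r_ne_zero

theorem map_derivative (h : RiccatiSolution D₀ φ s r D τ f) :
    algebraMap F U s * τ (D f)
      = -algebraMap F U r / f ^ 2 * D f + algebraMap F U (D₀ r) / f := by
  have hf0 := h.ne_zero
  have h1 := congrArg D h.riccati
  rw [Derivation.leibniz, map_add, h.derivation_map, h.derivation_algebraMap, smul_eq_mul,
    smul_eq_mul] at h1
  have h2 := h.riccati
  field_simp
  linear_combination f * h1 - D f * h2

/-- Differentiating the difference equation of `D^m f` gives that of `D^(m+1) f`. -/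
theorem map_derivative_succ (h : RiccatiSolution D₀ φ s r D τ f) {m : ℕ} {ρ : U}
    (hm : algebraMap F U s ^ m * τ (D^[m] f) = -algebraMap F U r / f ^ 2 * D^[m] f + ρ) :
    algebraMap F U s ^ (m + 1) * τ (D^[m + 1] f)
      = -algebraMap F U r / f ^ 2 * D^[m + 1] f
        + ((2 * algebraMap F U r * D f / f ^ 3 - algebraMap F U (D₀ r) / f ^ 2
            + m * (algebraMap F U (D₀ s) / algebraMap F U s) * (algebraMap F U r / f ^ 2))
              * D^[m] f
          + D ρ - m * (algebraMap F U (D₀ s) / algebraMap F U s) * ρ) := by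
  have hf0 := h.ne_zero
  have hs0 := h.algebraMap_s_ne_zero
  have hDg : D (-algebraMap F U r / f ^ 2)
      = -algebraMap F U (D₀ r) / f ^ 2 + 2 * algebraMap F U r * D f / f ^ 3 := by
    simp only [Derivation.leibniz_div, Derivation.leibniz_pow, map_neg, h.derivation_algebraMap,
      smul_eq_mul, nsmul_eq_mul]
    push_cast
    field_simp
    ring
  have hpow : D (algebraMap F U s ^ m)
      = m * (algebraMap F U (D₀ s) / algebraMap F U s) * algebraMap F U s ^ m := by
    rw [Derivation.leibniz_pow, h.derivation_algebraMap]
    -- The power rule involves the truncated exponent `m - 1`, so `m = 0` is separate.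
    rcases m with _ | m
    · simp
    · rw [Nat.add_sub_cancel, smul_eq_mul, nsmul_eq_mul]
      field_simp
      ring
  have h1 := congrArg D hm
  rw [map_add, Derivation.leibniz, Derivation.leibniz, h.derivation_map, hDg, hpow,
    ← Function.iterate_succ_apply' (f := D)] at h1
  simp only [smul_eq_mul] at h1
  linear_combination h1 - m * (algebraMap F U (D₀ s) / algebraMap F U s) * hm

/-- Level two is separate because here the inhomogeneity is quadratic in the preceding derivative;
from level three on it is linear. -/
theorem map_second_derivative (h : RiccatiSolution D₀ φ s r D τ f) :
    ∃ e : F, ∃ δ ∈ jetField F D f 1, algebraMap F U s ^ 2 * τ (D^[2] f)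
      = -algebraMap F U r / f ^ 2 * D^[2] f + (2 * algebraMap F U r / f ^ 3 * D f ^ 2
        + algebraMap F U e * algebraMap F U r / f ^ 2 * D f + δ) := by
  have hf0 := h.ne_zero
  have hr0 := h.algebraMap_r_ne_zero
  have h1 := h.map_derivative_succ (m := 1) (ρ := algebraMap F U (D₀ r) / f)
    (by rw [pow_one]; exact h.map_derivative)
  have hfm : f ∈ jetField F D f 1 := self_mem_jetField one_pos
  refine ⟨-2 * D₀ r / r + D₀ s / s, algebraMap F U (D₀ (D₀ r)) / f
    - algebraMap F U (D₀ s) / algebraMap F U s * (algebraMap F U (D₀ r) / f), ?_, ?_⟩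
  · exact sub_mem (div_mem (algebraMap_mem _ _) hfm) (mul_mem (div_mem (algebraMap_mem _ _)
      (algebraMap_mem _ _)) (div_mem (algebraMap_mem _ _) hfm))
  · rw [h1]
    simp only [Derivation.leibniz_div, h.derivation_algebraMap, smul_eq_mul, map_add, map_neg,
      map_mul, map_div₀, map_ofNat, Function.iterate_one, Nat.cast_one]
    field_simp
    ring

/-- The factor `2 * (n + 3)` is what the descent needs, being nonzero in characteristic zero: it
starts at 6, as `Df²` contributes 4 and `-r / f²` contributes 2, and grows by 2 at each
differentiation. -/
theorem map_higher_derivative (h : RiccatiSolution D₀ φ s r D τ f) (n : ℕ) :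
    ∃ e : F, ∃ δ ∈ jetField F D f (n + 2), algebraMap F U s ^ (n + 3) * τ (D^[n + 3] f)
      = -algebraMap F U r / f ^ 2 * D^[n + 3] f
        + ((2 * (n + 3) * algebraMap F U r * D f / f ^ 3
          + algebraMap F U e * algebraMap F U r / f ^ 2) * D^[n + 2] f + δ) := by
  have hf0 := h.ne_zero
  have hr0 := h.algebraMap_r_ne_zero
  have hD : ∀ {j : ℕ} {y : U}, y ∈ jetField F D f j → D y ∈ jetField F D f (j + 1) :=
    fun hy => derivation_mem_jetField_succ h.derivation_algebraMap hy
  have hfm : ∀ {j}, f ∈ jetField F D f (j + 1) := self_mem_jetField (Nat.succ_pos _)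
  have hDfm : ∀ {j}, D f ∈ jetField F D f (j + 2) := iterate_mem_jetField (i := 1) (by omega)
  induction n with
  | zero =>
    obtain ⟨e, δ, hδ, h2⟩ := h.map_second_derivative
    have hA := hD (j := 1) (div_mem (mul_mem (ofNat_mem _ 2) (algebraMap_mem _ r))
      (pow_mem hfm 3))
    have hB := hD (j := 1) (div_mem (mul_mem (algebraMap_mem _ e) (algebraMap_mem _ r))
      (pow_mem hfm 2))
    have hδ' := jetField_mono (F := F) (D := D) (f := f) (show 1 ≤ 2 by norm_num) hδ
    have hδD := hD hδ
    refine ⟨e - D₀ r / r + 2 * (D₀ s / s), D (2 * algebraMap F U r / f ^ 3) * D f ^ 2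
      + D (algebraMap F U e * algebraMap F U r / f ^ 2) * D f + D δ
      - 2 * (algebraMap F U (D₀ s) / algebraMap F U s)
        * (2 * algebraMap F U r / f ^ 3 * D f ^ 2
        + algebraMap F U e * algebraMap F U r / f ^ 2 * D f + δ), ?_, ?_⟩
    · exact sub_mem (add_mem (add_mem (mul_mem hA (pow_mem hDfm 2)) (mul_mem hB hDfm)) hδD)
        (mul_mem (mul_mem (ofNat_mem _ 2) (div_mem (algebraMap_mem _ _) (algebraMap_mem _ _)))
          (quadratic_mem_intermediateField e r hfm hDfm hδ'))
    · rw [h.map_derivative_succ h2, map_add, map_add, Derivation.leibniz, Derivation.leibniz,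
        Derivation.leibniz_pow]
      simp only [smul_eq_mul, nsmul_eq_mul, map_add, map_sub, map_mul, map_div₀, map_ofNat,
        Nat.cast_zero, zero_add, Nat.cast_ofNat, Nat.reduceAdd, Nat.reduceSub, pow_one,
        Function.iterate_succ_apply', Function.iterate_zero_apply]
      field_simp
      ring
  | succ n ih =>
    obtain ⟨e, δ, hδ, h2⟩ := ih
    set c := 2 * (n + 3) * algebraMap F U r * D f / f ^ 3
          + algebraMap F U e * algebraMap F U r / f ^ 2 with hc
    have hcm : c ∈ jetField F D f 2 := linear_coeff_mem_intermediateField n e r hfm hDfm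
    have hx : D^[n + 2] f ∈ jetField F D f (n + 3) := iterate_mem_jetField (by omega)
    have hcm' := jetField_mono (F := F) (D := D) (f := f) (show 2 ≤ n + 3 by omega) hcm
    have hcD := jetField_mono (F := F) (D := D) (f := f) (show 3 ≤ n + 3 by omega) (hD hcm)
    have hδ' := jetField_mono (F := F) (D := D) (f := f) (show n + 2 ≤ n + 3 by omega) hδ
    have hδD := hD hδ
    refine ⟨e - D₀ r / r + (n + 3) * (D₀ s / s), D c * D^[n + 2] f + D δ
      - (n + 3) * (algebraMap F U (D₀ s) / algebraMap F U s) * (c * D^[n + 2] f + δ), ?_, ?_⟩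
    · exact sub_mem (add_mem (mul_mem hcD hx) hδD) (mul_mem (mul_mem (add_mem (natCast_mem _ n)
        (ofNat_mem _ 3)) (div_mem (algebraMap_mem _ _) (algebraMap_mem _ _)))
        (add_mem (mul_mem hcm' hx) hδ'))
    · rw [h.map_derivative_succ h2, map_add, Derivation.leibniz,
        ← Function.iterate_succ_apply' (f := D)]
      simp only [smul_eq_mul, map_add, map_sub, map_mul, map_div₀, map_ofNat, map_natCast]
      push_cast
      rw [show n + 1 + 2 = n + 3 by ring, show n + 2 + 1 = n + 3 by ring,
        show n + 1 + 3 = n + 3 + 1 by ring]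
      have hcc : c * D^[n + 3] f = (2 * (n + 3) * algebraMap F U r * D f / f ^ 3
          + algebraMap F U e * algebraMap F U r / f ^ 2) * D^[n + 3] f := by rw [hc]
      linear_combination (norm := skip) hcc
      field_simp
      ring

/-- Every derivative of `f` satisfies an affine difference equation over the preceding ones. -/
theorem exists_map_iterate (h : RiccatiSolution D₀ φ s r D τ f) {m : ℕ} (hm : m ≠ 0) :
    ∃ ρ ∈ jetField F D f m,
      algebraMap F U s ^ m * τ (D^[m] f) = -algebraMap F U r / f ^ 2 * D^[m] f + ρ := by
  have hfm : ∀ {j}, f ∈ jetField F D f (j + 1) := self_mem_jetField (Nat.succ_pos _)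
  have hDfm : ∀ {j}, D f ∈ jetField F D f (j + 2) := iterate_mem_jetField (i := 1) (by omega)
  rcases m with _ | _ | _ | n
  · exact absurd rfl hm
  · exact ⟨_, div_mem (algebraMap_mem _ (D₀ r)) hfm, by
      simpa using h.map_derivative⟩
  · obtain ⟨e, δ, hδ, h2⟩ := h.map_second_derivative
    have hδ' := jetField_mono (F := F) (D := D) (f := f) (show 1 ≤ 2 by norm_num) hδ
    exact ⟨_, quadratic_mem_intermediateField e r hfm hDfm hδ', h2⟩
  · obtain ⟨e, δ, hδ, h2⟩ := h.map_higher_derivative n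
    have hδ' := jetField_mono (F := F) (D := D) (f := f) (show n + 2 ≤ n + 3 by omega) hδ
    have hx : D^[n + 2] f ∈ jetField F D f (n + 3) := iterate_mem_jetField (by omega)
    exact ⟨_, add_mem (mul_mem (linear_coeff_mem_intermediateField n e r hfm hDfm) hx) hδ', h2⟩

theorem map_mem_jetField (h : RiccatiSolution D₀ φ s r D τ f) {j : ℕ} {y : U}
    (hy : y ∈ jetField F D f j) : τ y ∈ jetField F D f j := by
  induction hy using IntermediateField.adjoin_induction with
  | mem x hx =>
    obtain ⟨i, hi, rfl⟩ := hx
    change τ (D^[i] f) ∈ _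
    have hf0 := h.ne_zero
    have hfm : f ∈ jetField F D f j := self_mem_jetField (Nat.zero_lt_of_lt hi)
    rcases eq_or_ne i 0 with rfl | hi0
    · rw [Function.iterate_zero_apply, eq_div_of_mul_eq hf0 h.riccati]
      exact div_mem (add_mem hfm (algebraMap_mem _ _)) hfm
    · obtain ⟨ρ, hρ, e⟩ := h.exists_map_iterate hi0
      rw [eq_div_of_mul_eq (pow_ne_zero i h.algebraMap_s_ne_zero) ((mul_comm _ _).trans e)]
      have hρ' := jetField_mono (Set.mem_Iio.1 hi).le hρ
      have hx : D^[i] f ∈ jetField F D f j := iterate_mem_jetField hi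
      exact div_mem (add_mem (mul_mem (div_mem (neg_mem (algebraMap_mem _ _)) (pow_mem hfm 2)) hx)
        hρ') (pow_mem (algebraMap_mem _ _) i)
  | algebraMap a => rw [h.map_algebraMap]; exact algebraMap_mem _ _
  | add x y hx hy ihx ihy => rw [map_add]; exact add_mem ihx ihy
  | inv x hx ih => rw [map_inv₀]; exact inv_mem ih
  | mul x y hx hy ihx ihy => rw [map_mul]; exact mul_mem ihx ihy

end RiccatiSolution

end Jets

/-! ### Descent of solvability to the first level of the tower. -/

section Descent

variable {F : Type u} {U : Type v} [Field F] [Field U] [Algebra F U]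

/-- The affine difference equation satisfied by `D^m f` has a solution in
`F(f, Df, …, D^(m-1) f)`. -/
def JetSolvable (s r : F) (D : Derivation ℤ U U) (τ : U →+* U) (f : U) (m : ℕ) : Prop :=
  ∃ z ∈ jetField F D f m,
    τ z - -algebraMap F U r / f ^ 2 / algebraMap F U s ^ m * z
      = τ (D^[m] f) - -algebraMap F U r / f ^ 2 / algebraMap F U s ^ m * D^[m] f

/-- Level `i` of the jet tower is transcendental and its difference equation has no solution in
the preceding field. -/
def JetGeneric (s r : F) (D : Derivation ℤ U U) (τ : U →+* U) (f : U) (i : ℕ) : Prop :=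
  Transcendental (jetField F D f i) (D^[i] f) ∧ ¬ JetSolvable s r D τ f i

namespace RiccatiSolution

variable {D₀ : Derivation ℤ F F} {φ : F →+* F} {s r : F} {D : Derivation ℤ U U} {τ : U →+* U}
  {f : U}

/-- This packages level `j` for the affine lemmas: `τ` restricts to the jet field, and a fixed point
of the affine map is the same as solvability at level `j`. -/
theorem exists_affine_jet (h : RiccatiSolution D₀ φ s r D τ f) {j : ℕ} (hj : j ≠ 0) :
    ∃ (ψ : jetField F D f j →+* jetField F D f j) (α β : jetField F D f j),
      (∀ a, τ (algebraMap _ U a) = algebraMap _ U (ψ a)) ∧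
      algebraMap _ U α = -algebraMap F U r / f ^ 2 / algebraMap F U s ^ j ∧ α ≠ 0 ∧
      τ (D^[j] f) = algebraMap _ U α * D^[j] f + algebraMap _ U β ∧
      ((∃ z, ψ z = α * z + β) ↔ JetSolvable s r D τ f j) := by
  have hfm : f ∈ jetField F D f j := self_mem_jetField (Nat.pos_of_ne_zero hj)
  have hs0 := pow_ne_zero j h.algebraMap_s_ne_zero
  obtain ⟨ρ, hρ, e⟩ := h.exists_map_iterate hj
  let ψ : jetField F D f j →+* jetField F D f j :=
    τ.restrict (jetField F D f j) (jetField F D f j) fun x hx => h.map_mem_jetField hx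
  let α : jetField F D f j := ⟨-algebraMap F U r / f ^ 2 / algebraMap F U s ^ j,
    div_mem (div_mem (neg_mem (algebraMap_mem _ _)) (pow_mem hfm 2))
      (pow_mem (algebraMap_mem _ _) j)⟩
  let β : jetField F D f j := ⟨ρ / algebraMap F U s ^ j,
    div_mem hρ (pow_mem (algebraMap_mem _ _) j)⟩
  have hx : τ (D^[j] f) = -algebraMap F U r / f ^ 2 / algebraMap F U s ^ j * D^[j] f
      + ρ / algebraMap F U s ^ j := by
    rw [eq_div_of_mul_eq hs0 ((mul_comm _ _).trans e)]
    ring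
  refine ⟨ψ, α, β, fun _ => rfl, rfl, ?_, hx, ?_⟩
  · intro h0
    exact div_ne_zero (div_ne_zero (neg_ne_zero.2 h.algebraMap_r_ne_zero)
      (pow_ne_zero 2 h.ne_zero)) hs0 (congrArg Subtype.val h0)
  · constructor
    · rintro ⟨z, hz⟩
      refine ⟨z, z.2, ?_⟩
      have hz' : τ z = -algebraMap F U r / f ^ 2 / algebraMap F U s ^ j * z
        + ρ / algebraMap F U s ^ j := congrArg Subtype.val hz
      rw [hx, hz']
      ring
    · rintro ⟨z, hz, hz'⟩
      refine ⟨⟨z, hz⟩, Subtype.ext ?_⟩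
      change τ z = -algebraMap F U r / f ^ 2 / algebraMap F U s ^ j * z
        + ρ / algebraMap F U s ^ j
      rw [hx] at hz'
      linear_combination hz'

theorem charZero_jetField [CharZero F] (D : Derivation ℤ U U) (f : U) (j : ℕ) :
    CharZero (jetField F D f j) :=
  charZero_of_injective_algebraMap (algebraMap F _).injective

/-- Generic jet fields contain no nonzero semi-invariant of nonzero weight. -/
theorem semiinvariant_eq_zero [CharZero F] (h : RiccatiSolution D₀ φ s r D τ f) :
    ∀ j : ℕ, 1 ≤ j → (∀ i, 1 ≤ i → i < j → JetGeneric s r D τ f i) →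
      ∀ y ∈ jetField F D f j, ∀ (c : F) (k : ℕ), k ≠ 0 →
        τ y = algebraMap F U c * f ^ (2 * k) * y → y = 0 := by
  intro j hj
  induction j, hj using Nat.le_induction with
  | base =>
    intro _ y hy c k hk hyτ
    exact eq_zero_of_semiinvariant h.map_algebraMap h.r_ne_zero h.riccati h.no_algebraic
      (exists_aeval_div_of_mem_jetField_one hy) hk hyτ
  | succ j hj ih =>
    intro hgen y hy c k hk hyτ
    rcases eq_or_ne c 0 with rfl | hc
    · exact (map_eq_zero τ).1 (by simpa using hyτ)
    have := charZero_jetField (F := F) D f j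
    obtain ⟨htr, hns⟩ := hgen j hj (Nat.lt_succ_self j)
    obtain ⟨ψ, α, β, hψ, -, hα0, hx, hsol⟩ := h.exists_affine_jet (j := j) (by omega)
    have hfm : f ∈ jetField F D f j := self_mem_jetField (by omega)
    let c' : jetField F D f j := ⟨algebraMap F U c * f ^ (2 * k),
      mul_mem (algebraMap_mem _ _) (pow_mem hfm _)⟩
    have hc' : c' ≠ 0 := fun h0 =>
      mul_ne_zero (by simpa using hc) (pow_ne_zero _ h.ne_zero) (congrArg Subtype.val h0)
    obtain ⟨a, rfl⟩ := mem_range_algebraMap_of_semiinvariant hψ hα0 hx htr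
      (fun hz => hns (hsol.1 hz)) (exists_aeval_div_of_mem_jetField_succ hy) hc' hyτ
    exact ih (fun i hi hij => hgen i hi (by omega)) _ a.2 c k hk hyτ

/-- The leading coefficient of a solution polynomial vanishes when its weight is nonzero. -/
theorem leadingCoeff_eq_zero [CharZero F] (h : RiccatiSolution D₀ φ s r D τ f) {j : ℕ}
    (hj : 1 ≤ j) (hgen : ∀ i, 1 ≤ i → i < j → JetGeneric s r D τ f i) {a : U}
    (ha : a ∈ jetField F D f j) {c : F} {d e : ℕ} (hed : e < d)
    (haτ : τ a * (-algebraMap F U r / f ^ 2 / algebraMap F U s ^ j) ^ d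
      = algebraMap F U c / f ^ (2 * e) * a) : a = 0 := by
  have hf0 := h.ne_zero
  have hs0 := h.algebraMap_s_ne_zero
  have hr0 := h.algebraMap_r_ne_zero
  -- The factor `f^(-2d)` on the left against `f^(-2e)` on the right leaves the weight `f^(2(d -
  -- e))`.
  refine h.semiinvariant_eq_zero j hj hgen a ha (c / (-r / s ^ j) ^ d) (d - e) (by omega) ?_
  have hne : (-algebraMap F U r / f ^ 2 / algebraMap F U s ^ j) ^ d ≠ 0 :=
    pow_ne_zero _ (div_ne_zero (div_ne_zero (neg_ne_zero.2 hr0) (pow_ne_zero _ hf0))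
      (pow_ne_zero _ hs0))
  rw [eq_div_of_mul_eq hne haτ]
  obtain ⟨k, rfl⟩ := Nat.exists_eq_add_of_lt hed
  rw [show e + k + 1 - e = k + 1 by omega]
  simp only [map_div₀, map_pow, map_neg, div_pow]
  have hr1 : (-algebraMap F U r) ^ (e + k + 1) ≠ 0 := pow_ne_zero _ (neg_ne_zero.2 hr0)
  field_simp
  ring

/-- The difference equation of a logarithmic second derivative has no solution in generic jet
fields. -/
theorem not_exists_connection [CharZero F] (h : RiccatiSolution D₀ φ s r D τ f) :
    ∀ j : ℕ, 2 ≤ j → (∀ i, 1 ≤ i → i < j → JetGeneric s r D τ f i) →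
      ∀ ζ ∈ jetField F D f j, ∀ κ e : F, κ ≠ 0 →
        algebraMap F U s * τ ζ
          ≠ ζ - algebraMap F U κ * D f / f + algebraMap F U e := by
  have hf0 := h.ne_zero
  have hs0 := h.algebraMap_s_ne_zero
  intro j hj
  induction j, hj using Nat.le_induction with
  | base =>
    intro hgen ζ hζ κ e hκ hζτ
    have := charZero_jetField (F := F) D f 1
    obtain ⟨htr, hns⟩ := hgen 1 le_rfl (by norm_num)
    obtain ⟨ψ, α, β, hψ, hα, hα0, hx, hsol⟩ := h.exists_affine_jet (j := 1) (by norm_num)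
    have hfm : f ∈ jetField F D f 1 := self_mem_jetField one_pos
    let c : jetField F D f 1 := ⟨(algebraMap F U s)⁻¹, inv_mem (algebraMap_mem _ _)⟩
    have hc : c ≠ 0 := fun h0 => inv_ne_zero hs0 (congrArg Subtype.val h0)
    let b₁ : jetField F D f 1 := ⟨-algebraMap F U κ / f / algebraMap F U s,
      div_mem (div_mem (neg_mem (algebraMap_mem _ _)) hfm) (algebraMap_mem _ _)⟩
    let b₀ : jetField F D f 1 := ⟨algebraMap F U e / algebraMap F U s,
      div_mem (algebraMap_mem _ _) (algebraMap_mem _ _)⟩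
    obtain ⟨p, -, -, hp⟩ := exists_aeval_natDegree_le_of_affine_eq hψ hα0 hx htr
      (fun hz => hns (hsol.1 hz)) (exists_aeval_div_of_mem_jetField_succ hζ) hc
      (e := C b₁ * X + C b₀) (k := 1) (by
        rw [map_add, map_mul, aeval_X, aeval_C, aeval_C]
        change τ ζ = (algebraMap F U s)⁻¹ * ζ + (-algebraMap F U κ / f / algebraMap F U s * D f
          + algebraMap F U e / algebraMap F U s)
        rw [eq_div_of_mul_eq hs0 ((mul_comm _ _).trans hζτ)]
        ring) natDegree_linear_le (by
        intro d hd a ha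
        have ha' := congrArg (algebraMap _ U) ha
        rw [map_mul, map_mul, map_pow, hα, ← hψ] at ha'
        refine Subtype.ext (h.leadingCoeff_eq_zero (j := 1) le_rfl (by omega) a.2 (c := s⁻¹)
          (d := d) (e := 0) (by omega) (ha'.trans ?_))
        rw [map_inv₀, mul_zero, pow_zero, div_one]
        rfl)
    have hp' := congrArg (algebraMap _ U) hp
    rw [pow_one, map_mul, map_add, map_mul, hα, ← hψ] at hp'
    simp only [coeff_add, coeff_C_mul, coeff_X_one, coeff_C_succ, mul_one, add_zero] at hp'
    -- The linear coefficient of `ζ` in `Df` satisfies the excluded equation over `F(f)`.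
    refine riccati_no_invariant_connection h.map_algebraMap h.r_ne_zero h.riccati h.no_algebraic
      (exists_aeval_div_of_mem_jetField_one (p.coeff 1).2) hκ ?_
    have hp'' : τ (p.coeff 1 : U) * (-algebraMap F U r / f ^ 2 / algebraMap F U s ^ 1)
        = (algebraMap F U s)⁻¹ * (p.coeff 1 : U) + -algebraMap F U κ / f / algebraMap F U s := hp'
    rw [map_neg]
    field_simp at hp'' ⊢
    linear_combination hp''
  | succ j hj ih =>
    intro hgen ζ hζ κ e hκ hζτ
    have := charZero_jetField (F := F) D f j
    obtain ⟨htr, hns⟩ := hgen j (by omega) (Nat.lt_succ_self j)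
    obtain ⟨ψ, α, β, hψ, hα, hα0, hx, hsol⟩ := h.exists_affine_jet (j := j) (by omega)
    have hfm : f ∈ jetField F D f j := self_mem_jetField (by omega)
    have hDfm : D f ∈ jetField F D f j := iterate_mem_jetField (i := 1) (by omega)
    have hgen' : ∀ i, 1 ≤ i → i < j → JetGeneric s r D τ f i :=
      fun i hi hij => hgen i hi (by omega)
    let c : jetField F D f j := ⟨(algebraMap F U s)⁻¹, inv_mem (algebraMap_mem _ _)⟩
    have hc : c ≠ 0 := fun h0 => inv_ne_zero hs0 (congrArg Subtype.val h0)
    let b : jetField F D f j := ⟨(-algebraMap F U κ * D f / f + algebraMap F U e)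
        / algebraMap F U s, div_mem (add_mem (div_mem (mul_mem (neg_mem (algebraMap_mem _ _))
          hDfm) hfm) (algebraMap_mem _ _)) (algebraMap_mem _ _)⟩
    obtain ⟨p, hζp, hp, -⟩ := exists_aeval_natDegree_le_of_affine_eq hψ hα0 hx htr
      (fun hz => hns (hsol.1 hz)) (exists_aeval_div_of_mem_jetField_succ hζ) hc
      (e := C b) (k := 0) (by
        rw [aeval_C]
        change τ ζ = (algebraMap F U s)⁻¹ * ζ + (-algebraMap F U κ * D f / f + algebraMap F U e)
          / algebraMap F U s
        rw [eq_div_of_mul_eq hs0 ((mul_comm _ _).trans hζτ)]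
        ring) (by simp) (by
        intro d hd a ha
        have ha' := congrArg (algebraMap _ U) ha
        rw [map_mul, map_mul, map_pow, hα, ← hψ] at ha'
        refine Subtype.ext (h.leadingCoeff_eq_zero (j := j) (by omega) hgen' a.2 (c := s⁻¹)
          (d := d) (e := 0) (by omega) (ha'.trans ?_))
        rw [map_inv₀, mul_zero, pow_zero, div_one]
        rfl)
    -- For `j ≥ 2` the inhomogeneity already lies in the jet field `j`, so `ζ` is constant in `D^j
    -- f` and descends one level.
    obtain ⟨a, rfl⟩ := natDegree_eq_zero.1 (Nat.le_zero.1 hp)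
    rw [aeval_C] at hζp
    exact ih hgen' ζ (hζp ▸ a.2) κ e hκ hζτ

/-- A solution is quadratic in `Df`, and its `Df²` coefficient satisfies `-r / f² * τ y = y - 2 /
f`. -/
theorem not_jetSolvable_two [CharZero F] (h : RiccatiSolution D₀ φ s r D τ f)
    (hgen : JetGeneric s r D τ f 1) : ¬ JetSolvable s r D τ f 2 := by
  rintro ⟨z, hz, hzτ⟩
  have hf0 := h.ne_zero
  have hs0 := h.algebraMap_s_ne_zero
  have hr0 := h.algebraMap_r_ne_zero
  have := charZero_jetField (F := F) D f 1
  obtain ⟨htr, hns⟩ := hgen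
  obtain ⟨ψ, α, β, hψ, hα, hα0, hx, hsol⟩ := h.exists_affine_jet (j := 1) (by norm_num)
  have hfm : f ∈ jetField F D f 1 := self_mem_jetField one_pos
  obtain ⟨ε, δ, hδ, h2⟩ := h.map_second_derivative
  let c : jetField F D f 1 := ⟨-algebraMap F U r / f ^ 2 / algebraMap F U s ^ 2,
    div_mem (div_mem (neg_mem (algebraMap_mem _ _)) (pow_mem hfm 2))
      (pow_mem (algebraMap_mem _ _) 2)⟩
  have hc : c ≠ 0 := fun h0 => div_ne_zero (div_ne_zero (neg_ne_zero.2 hr0) (pow_ne_zero 2 hf0))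
    (pow_ne_zero 2 hs0) (congrArg Subtype.val h0)
  let b₂ : jetField F D f 1 := ⟨2 * algebraMap F U r / f ^ 3 / algebraMap F U s ^ 2,
    div_mem (div_mem (mul_mem (ofNat_mem _ 2) (algebraMap_mem _ _)) (pow_mem hfm 3))
      (pow_mem (algebraMap_mem _ _) 2)⟩
  let b₁ : jetField F D f 1 :=
    ⟨algebraMap F U ε * algebraMap F U r / f ^ 2 / algebraMap F U s ^ 2,
    div_mem (div_mem (mul_mem (algebraMap_mem _ _) (algebraMap_mem _ _)) (pow_mem hfm 2))
      (pow_mem (algebraMap_mem _ _) 2)⟩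
  let b₀ : jetField F D f 1 := ⟨δ / algebraMap F U s ^ 2,
    div_mem hδ (pow_mem (algebraMap_mem _ _) 2)⟩
  obtain ⟨p, -, -, hp⟩ := exists_aeval_natDegree_le_of_affine_eq hψ hα0 hx htr
    (fun hz => hns (hsol.1 hz)) (exists_aeval_div_of_mem_jetField_succ hz) hc
    (e := C b₂ * X ^ 2 + C b₁ * X + C b₀) (k := 2) (by
      rw [map_add, map_add, map_mul, map_mul, map_pow, aeval_X, aeval_C, aeval_C, aeval_C]
      change τ z = -algebraMap F U r / f ^ 2 / algebraMap F U s ^ 2 * z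
        + (2 * algebraMap F U r / f ^ 3 / algebraMap F U s ^ 2 * D f ^ 2
          + algebraMap F U ε * algebraMap F U r / f ^ 2 / algebraMap F U s ^ 2 * D f
          + δ / algebraMap F U s ^ 2)
      rw [eq_div_of_mul_eq (pow_ne_zero 2 hs0) ((mul_comm _ _).trans h2)] at hzτ
      linear_combination hzτ) natDegree_quadratic_le (by
      intro d hd a ha
      have ha' := congrArg (algebraMap _ U) ha
      rw [map_mul, map_mul, map_pow, hα, ← hψ] at ha'
      refine Subtype.ext (h.leadingCoeff_eq_zero (j := 1) le_rfl (by omega) a.2 (c := -r / s ^ 2)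
        (d := d) (e := 1) (by omega) (ha'.trans ?_))
      change -algebraMap F U r / f ^ 2 / algebraMap F U s ^ 2 * _ = _
      rw [map_div₀, map_neg, map_pow, mul_one, div_right_comm]
      rfl)
  have hp' := congrArg (algebraMap _ U) hp
  rw [map_mul, map_add, map_mul, map_pow, hα, ← hψ] at hp'
  simp only [coeff_add, coeff_C_mul, coeff_X_pow, coeff_X, coeff_C_succ] at hp'
  norm_num at hp'
  have hp'' : τ (p.coeff 2 : U) * (-algebraMap F U r / f ^ 2 / algebraMap F U s) ^ 2
      = -algebraMap F U r / f ^ 2 / algebraMap F U s ^ 2 * (p.coeff 2 : U)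
        + 2 * algebraMap F U r / f ^ 3 / algebraMap F U s ^ 2 := hp'
  refine riccati_no_invariant_connection h.map_algebraMap h.r_ne_zero h.riccati h.no_algebraic
    (exists_aeval_div_of_mem_jetField_one (p.coeff 2).2) (κ := 2) two_ne_zero ?_
  rw [map_neg, map_ofNat]
  field_simp at hp'' ⊢
  linear_combination -hp''

/-- A solution is linear in `D^(n+2) f`, and its linear coefficient satisfies the equation of
`not_exists_connection` with `κ = 2 * (n + 3)`. -/
theorem not_jetSolvable_add_three [CharZero F] (h : RiccatiSolution D₀ φ s r D τ f) {n : ℕ}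
    (hgen : ∀ i, 1 ≤ i → i < n + 3 → JetGeneric s r D τ f i) :
    ¬ JetSolvable s r D τ f (n + 3) := by
  rintro ⟨z, hz, hzτ⟩
  have hf0 := h.ne_zero
  have hs0 := h.algebraMap_s_ne_zero
  have hr0 := h.algebraMap_r_ne_zero
  have := charZero_jetField (F := F) D f (n + 2)
  obtain ⟨htr, hns⟩ := hgen (n + 2) (by omega) (by omega)
  obtain ⟨ψ, α, β, hψ, hα, hα0, hx, hsol⟩ := h.exists_affine_jet (j := n + 2) (by omega)
  have hfm : f ∈ jetField F D f (n + 2) := self_mem_jetField (by omega)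
  have hDfm : D f ∈ jetField F D f (n + 2) := iterate_mem_jetField (i := 1) (by omega)
  have hgen' : ∀ i, 1 ≤ i → i < n + 2 → JetGeneric s r D τ f i :=
    fun i hi hij => hgen i hi (by omega)
  obtain ⟨ε, δ, hδ, h2⟩ := h.map_higher_derivative n
  let c : jetField F D f (n + 2) := ⟨-algebraMap F U r / f ^ 2 / algebraMap F U s ^ (n + 3),
    div_mem (div_mem (neg_mem (algebraMap_mem _ _)) (pow_mem hfm 2))
      (pow_mem (algebraMap_mem _ _) _)⟩
  have hc : c ≠ 0 := fun h0 => div_ne_zero (div_ne_zero (neg_ne_zero.2 hr0) (pow_ne_zero 2 hf0))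
    (pow_ne_zero _ hs0) (congrArg Subtype.val h0)
  let b₁ : jetField F D f (n + 2) := ⟨(2 * (n + 3) * algebraMap F U r * D f / f ^ 3
    + algebraMap F U ε * algebraMap F U r / f ^ 2) / algebraMap F U s ^ (n + 3),
    div_mem (linear_coeff_mem_intermediateField n ε r hfm hDfm) (pow_mem (algebraMap_mem _ _) _)⟩
  let b₀ : jetField F D f (n + 2) := ⟨δ / algebraMap F U s ^ (n + 3),
    div_mem hδ (pow_mem (algebraMap_mem _ _) _)⟩
  obtain ⟨p, -, -, hp⟩ := exists_aeval_natDegree_le_of_affine_eq hψ hα0 hx htr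
    (fun hz => hns (hsol.1 hz)) (exists_aeval_div_of_mem_jetField_succ hz) hc
    (e := C b₁ * X + C b₀) (k := 1) (by
      rw [map_add, map_mul, aeval_X, aeval_C, aeval_C]
      change τ z = -algebraMap F U r / f ^ 2 / algebraMap F U s ^ (n + 3) * z
        + ((2 * (n + 3) * algebraMap F U r * D f / f ^ 3
          + algebraMap F U ε * algebraMap F U r / f ^ 2) / algebraMap F U s ^ (n + 3)
            * D^[n + 2] f + δ / algebraMap F U s ^ (n + 3))
      rw [eq_div_of_mul_eq (pow_ne_zero _ hs0) ((mul_comm _ _).trans h2)] at hzτ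
      linear_combination hzτ) natDegree_linear_le (by
      intro d hd a ha
      have ha' := congrArg (algebraMap _ U) ha
      rw [map_mul, map_mul, map_pow, hα, ← hψ] at ha'
      refine Subtype.ext (h.leadingCoeff_eq_zero (j := n + 2) (by omega) hgen' a.2
        (c := -r / s ^ (n + 3)) (d := d) (e := 1) (by omega) (ha'.trans ?_))
      change -algebraMap F U r / f ^ 2 / algebraMap F U s ^ (n + 3) * _ = _
      rw [map_div₀, map_neg, map_pow, mul_one, div_right_comm]
      rfl)
  have hp' := congrArg (algebraMap _ U) hp
  rw [pow_one, map_mul, map_add, map_mul, hα, ← hψ] at hp'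
  simp only [coeff_add, coeff_C_mul, coeff_X_one, coeff_C_succ, mul_one, add_zero] at hp'
  have hp'' : τ (p.coeff 1 : U) * (-algebraMap F U r / f ^ 2 / algebraMap F U s ^ (n + 2))
      = -algebraMap F U r / f ^ 2 / algebraMap F U s ^ (n + 3) * (p.coeff 1 : U)
        + (2 * (n + 3) * algebraMap F U r * D f / f ^ 3
          + algebraMap F U ε * algebraMap F U r / f ^ 2) / algebraMap F U s ^ (n + 3) := hp'
  refine h.not_exists_connection (n + 2) (by omega) hgen' _ (p.coeff 1).2 (2 * (n + 3)) (-ε)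
    (mul_ne_zero two_ne_zero (by exact_mod_cast Nat.succ_ne_zero (n + 2))) ?_
  simp only [map_mul, map_add, map_ofNat, map_natCast, map_neg]
  rw [pow_succ _ (n + 2)] at hp''
  field_simp at hp'' ⊢
  linear_combination -hp''

/-- If `f` is differentially algebraic then the equation of its first derivative is already
solvable in `F(f)`. -/
theorem jetSolvable_one [CharZero F] (h : RiccatiSolution D₀ φ s r D τ f)
    (hf : IsDifferentiallyAlgebraic F D f) : JetSolvable s r D τ f 1 := by
  classical
  have hex := exists_isAlgebraic_jetField hf
  obtain ⟨n, hn, hmin⟩ : ∃ n, IsAlgebraic (jetField F D f n) (D^[n] f) ∧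
      ∀ i < n, Transcendental (jetField F D f i) (D^[i] f) :=
    ⟨Nat.find hex, Nat.find_spec hex, fun i hi => Nat.find_min hex hi⟩
  have hn0 : n ≠ 0 := by
    rintro rfl
    have hbot : jetField F D f 0 = ⊥ := by
      rw [jetField, show Set.Iio 0 = (∅ : Set ℕ) by ext; simp, Set.image_empty,
        IntermediateField.adjoin_empty]
    rw [hbot] at hn
    refine transcendental_of_riccati h.map_algebraMap h.r_ne_zero h.riccati h.no_algebraic ?_
    exact hn.restrictScalars F
  have hsolv : ∃ m, 1 ≤ m ∧ m ≤ n ∧ JetSolvable s r D τ f m := by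
    have := charZero_jetField (F := F) D f n
    obtain ⟨ψ, α, β, hψ, -, hα0, hx, hsol⟩ := h.exists_affine_jet hn0
    exact ⟨n, by omega, le_rfl, hsol.1 (exists_fixedPoint_of_isAlgebraic hψ hα0 hx hn)⟩
  obtain ⟨h1, hmn, hm⟩ := Nat.find_spec hsolv
  -- The first solvable level is at most the first algebraic level `n`, so every level below it is
  -- both transcendental and unsolvable.
  have hgen : ∀ i, 1 ≤ i → i < Nat.find hsolv → JetGeneric s r D τ f i := fun i hi him =>
    ⟨hmin i (by omega), fun hi' => Nat.find_min hsolv him ⟨hi, by omega, hi'⟩⟩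
  generalize Nat.find hsolv = m at h1 hmn hm hgen
  match m, h1, hm, hgen with
  | 1, _, hm, _ => exact hm
  | 2, _, hm, hgen => exact absurd hm (h.not_jetSolvable_two (hgen 1 le_rfl (by norm_num)))
  | n + 3, _, hm, hgen => exact absurd hm (h.not_jetSolvable_add_three hgen)

end RiccatiSolution

end Descent

/-! ### The main theorem. -/

theorem mainTheorem1 {K : Type*} {F : Type*} {U : Type*}
    [Field K] [Field F] [Field U] [CharZero F] [Algebra K F] [Algebra F U]
    (hFK : IsAlgFunctionField K F)
    (D₀ : Derivation ℤ F F) (τ₀ : F →+* F)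
    (s : F) (hs : s ≠ 0) (hDτ₀ : ∀ x : F, D₀ (τ₀ x) = s * τ₀ (D₀ x))
    (r : F) (hr : r ≠ 0) (hDr : D₀ r ≠ 0)
    (hP : ∃ (P : FunctionFieldPlace K F) (w : AddValuation F (WithTop ℤ)),
      P.IsNormalizedValuation w ∧ ∀ i : ℕ, 0 < w (τ₀^[i] r))
    (hA : ∀ i : ℕ, 1 ≤ i → ¬ HasAlgebraicSolutionEq τ₀ !![1, r; 1, 0] i)
    (D : Derivation ℤ U U) (τ : U →+* U)
    (hD : IsDifferentialOverfield D₀ D) (hτ : IsDifferenceOverfield τ₀ τ)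
    (hDτ : ∀ x : U, D (τ x) = algebraMap F U s * τ (D x))
    (hf : ∃ f : U, IsSolutionEq τ₀ τ !![1, r; 1, 0] 1 f ∧ IsDifferentiallyAlgebraic F D f) :
    ∃ g : F,
      τ₀^[2] (s * r) * τ₀ s * s * τ₀^[3] g + (τ₀ r + 1) * τ₀ s * s * τ₀^[2] g
        - (τ₀ r + 1) * s * τ₀ g - r * g + s * τ₀ (D₀ r / r) = 0 := by
  obtain ⟨f, hsol, hfalg⟩ := hf
  have hric : τ f * f = f + algebraMap F U r := by
    simpa [IsSolutionEq, transformProd] using hsol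
  have h : RiccatiSolution D₀ τ₀ s r D τ f := ⟨hD, hτ, hDτ, hs, hr, hric, hA⟩
  obtain ⟨z, hz, hzτ⟩ := h.jetSolvable_one hfalg
  refine exists_third_order_solution hτ hr hric hA hs (r' := D₀ r)
    (exists_aeval_div_of_mem_jetField_one hz) ?_
  have hs0 := h.algebraMap_s_ne_zero
  have hf0 := h.ne_zero
  have h1 := h.map_derivative
  rw [pow_one, Function.iterate_one] at hzτ
  -- `z` and `Df` differ by a solution of the homogeneous equation, so `z` inherits the affine
  -- equation of `Df`.
  have h2 : algebraMap F U s * τ z - algebraMap F U s * τ (D f)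
      = -algebraMap F U r / f ^ 2 * z - -algebraMap F U r / f ^ 2 * D f := by
    have e : algebraMap F U s * (-algebraMap F U r / f ^ 2 / algebraMap F U s)
        = -algebraMap F U r / f ^ 2 := mul_div_cancel₀ _ hs0
    linear_combination algebraMap F U s * hzτ + (z - D f) * e
  linear_combination h2 + h1
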